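/- Let $X=\{0,1,2\}$ and let $X^{\omega}$ be the space of left-infinite words $\dots x_2x_1x_0$ over $X$, with the product topology; all actions are right actions. Let $a$ and $b$ be the generators of the Fabrykowski–Gupta group: $a$ adds $1$ (mod $3$) to the last letter, and $b=(a,\mathrm{Id},b)$, i.e. $v0\cdot b=(v\cdot a)0$, $v1\cdot b=v1$, $v2\cdot b=(v\cdot b)2$. Put $\xi=2^{\omega}$ and $W_n=X^{\omega}02^n$. All indices $i,j$ run over $\{1,2,3,4\}$ and are read modulo $4$. Let $e_1=(0,1,2,1)$ and $e_2=(1,1,1,0)$. Let $b_1^{(i)}$ and $b_2^{(i)}$ act on $W_n$ as $b^{e_1(i+n)}$ and $b^{e_2(i+n)}$ respectively, for every $n\ge 0$, and trivially outside $\bigcup_n W_n$. Put $H_i=\langle b_1^{(i)},b_2^{(i)}\rangle$ and $G_i=\langle a,H_i\rangle$. For the piece $P_{i,j}=\bigcup_{n\equiv j-i\ (4)}W_n$ let $\pi_j:H_i\to\mathbb Z/3$ be such that $h$ acts on $P_{i,j}$ as $b^{\pi_j(h)}$; connector $(j)$ is the Cayley graph of the image of $\pi_j$, a triangle on which the elements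 of $\ker\pi_j$ are loops. Traverses. For $k\ge 2$ let $\mathcal T_k$ be the tile of level $k$ (the words of length $k$), with boundary points $\eta_k=02^{k-1}$ and $\xi_k=2^k$. A bridge of rank $k$ with connector $(j)$ consists, for some $m\ge k$ with $i+m\equiv j\pmod 4$ and some tail $u$, of the three copies $uy02^{m-k}\mathcal T_k$ ($y\in X$) of $\mathcal T_k$ in an orbital graph of $G_i$; these copies are joined at their points $\xi_k$ by connector $(j)$. A word $w$ in the letters $\langle a\rangle\cup H_i$ performs a traverse of $2^{\omega}\mathcal T_k$, or of a bridge, if its walk stays there, starts and ends at a point $\eta_k$ of a copy of $\mathcal T_k$, touches no such point in between, and visits a point $\xi_k$. The graph of germs of $G_i$ at $\xi$ has as vertices the germs at $\xi$ of the elements of $G_i$; the germ of $g$ lies in the branch of $h\in H_i$ if near $\xi$ the words $x\cdot g$ and $x\cdot h$ agree except possibly in a fixed number of last letters. A word $w$ is a rank $k$ traverse of type $h$ if it performs a traverse of $2^{\omega}\mathcal T_k$ from $2^\omega\eta_k$ whose lift to the graph of germs goes from the branch of $\mathrm{Id}$ to the branch of $h$. It is a rank $k$ traverse of type $c\in\mathbb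 Z/3$ passing through connector $(j)$ if on every bridge of rank $k$ with connector $(j)$, from the point $\eta_k$ of every copy $y$ of $\mathcal T_k$, it performs a traverse that ends in copy $y+c$; for $c=0$ it is said to be of type $\mathrm{Id}$. Then the following hold. 1. $b_1^{(i)}=(a^{e_1(i)},\mathrm{Id},b_1^{(i+1)})$ and $b_2^{(i)}=(a^{e_2(i)},\mathrm{Id},b_2^{(i+1)})$, and $(G_i)$ is a self-similar family: for all $g\in G_i$ and $y\in X$ there are $g'\in G_{i+1}$ and $y'\in X$ with $vy\cdot g=(v\cdot g')y'$ for all $v$. 2. $H_i\cong(\mathbb Z/3)^2$. $H_i$ is a fragmentation of $b$: its elements are trivial on $\mathrm{Fix}(b)$, each $\pi_j$ is well defined, and $\pi_j(b_1^{(i)})=e_1(j)$, $\pi_j(b_2^{(i)})=e_2(j)$. Every non-identity $h\in H_i$ has exactly one $j$ with $\pi_j(h)=0$. The group $H_i$ fixes $\xi$ and is the group of germs of $G_i$ at $\xi$ (every $g\in G_i$ fixing $\xi$ coincides near $\xi$ with exactly one $h\in H_i$), and every germ at $\xi$ of an element of $G_i$ lies in the branch of exactly one $h\in H_i$. 3.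 Let $k\ge 2$, $\mathrm{Id}\ne h\in H_i$, and let $w$ be a rank $k$ traverse of type $h$. Then for every $j$, $w$ is a rank $k$ traverse of type $\pi_j(h)$ passing through connector $(j)$. Whenever $w$ is a rank $k$ traverse of nontrivial type passing through connector $(j)$, there is $j'\ne j$ such that $w$ is a rank $k$ traverse of type $\mathrm{Id}$ passing through connector $(j')$. 4. Let $\eta=(3/4)^{1/3}$. For every $i$, every finite symmetric generating set of $G_i$ and every $\alpha>\frac{\log 3}{\log 3-\log\eta}\approx 0.9197$ (with error less than $5\cdot10^{-5}$), the corresponding growth function satisfies $\gamma_{G_i}(R)\preccurlyeq\exp(R^{\alpha})$: there is $C\ge 1$ with $\gamma_{G_i}(R)\le\exp((CR)^{\alpha})$ for all $R\ge 1$. -/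

import Mathlib

open Filter Topology

noncomputable section

namespace FabrykowskiGupta

/-- The space of left-infinite words over the alphabet `{0, 1, 2}`, with the product topology.
The letter `x 0` is the rightmost letter, the one read first: `x = … x 2, x 1, x 0`.
It is the boundary of the ternary rooted tree. -/
abbrev Pt : Type := ℕ → ZMod 3

/-- The word `v y`: the letter `y` appended on the right of `v`. -/
def snoc (v : Pt) (y : ZMod 3) : Pt
  | 0 => y
  | n + 1 => v n

/-- The singular point `… 2 2 2`. -/
def xi : Pt := fun _ => 2

/-- `W n` is the set of words ending in `0 2 ⋯ 2` with exactly `n` letters `2`. -/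
def W (n : ℕ) : Set Pt := {x | x n = 0 ∧ ∀ k < n, x k = 2}

/-- The generator `a = (0 1 2)`: it adds `1` to the rightmost letter. -/
def a : Equiv.Perm Pt where
  toFun x := snoc (fun n => x (n + 1)) (x 0 + 1)
  invFun x := snoc (fun n => x (n + 1)) (x 0 - 1)
  left_inv x := by
    funext n
    cases n <;> simp [snoc]
  right_inv x := by
    funext n
    cases n <;> simp [snoc]

/-- The map that adds `c n` to the letter with index `n + 1` of the words in `W n`, for every `n`,
and changes nothing else. -/
def twistFun (c : ℕ → ZMod 3) (x : Pt) : Pt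
  | 0 => x 0
  | n + 1 => if x n = 0 ∧ ∀ k < n, x k = 2 then x (n + 1) + c n else x (n + 1)

theorem twistFun_mem_W (c : ℕ → ZMod 3) (x : Pt) (n : ℕ) :
    twistFun c x ∈ W n ↔ x ∈ W n := by
  have key : ∀ n, (∀ k < n, x k = 2) → ∀ k ≤ n, twistFun c x k = x k := by
    intro n hn k hk
    cases k with
    | zero => rfl
    | succ k =>
      have h2 : x k = 2 := hn k (by omega)
      have : ¬ (x k = 0 ∧ ∀ j < k, x j = 2) := by
        rintro ⟨h0, -⟩
        rw [h0] at h2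
        exact absurd h2 (by decide)
      simp only [twistFun, if_neg this]
  have key' : ∀ n, (∀ k < n, twistFun c x k = 2) → ∀ k < n, x k = 2 := by
    intro n
    induction n with
    | zero => intro _ k hk; omega
    | succ n ih =>
      intro h k hk
      have h1 := ih (fun k hk => h k (by omega))
      have h2 := key n h1 k (by omega)
      rw [← h2]
      exact h k hk
  constructor
  · rintro ⟨h0, h2⟩
    have h3 := key' n h2
    exact ⟨by rw [← key n h3 n le_rfl]; exact h0, h3⟩
  · rintro ⟨h0, h2⟩
    exact ⟨by rw [key n h2 n le_rfl]; exact h0,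
      fun k hk => by rw [key n h2 k hk.le]; exact h2 k hk⟩

theorem twistFun_twistFun (c d : ℕ → ZMod 3) (x : Pt) :
    twistFun c (twistFun d x) = twistFun (fun n => d n + c n) x := by
  funext m
  cases m with
  | zero => rfl
  | succ n =>
    have h : (twistFun d x n = 0 ∧ ∀ k < n, twistFun d x k = 2) ↔
        (x n = 0 ∧ ∀ k < n, x k = 2) := twistFun_mem_W d x n
    by_cases hx : x n = 0 ∧ ∀ k < n, x k = 2
    · have hd : twistFun d x (n + 1) = x (n + 1) + d n := if_pos hx
      have h1 : twistFun c (twistFun d x) (n + 1) = twistFun d x (n + 1) + c n :=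
        if_pos (h.2 hx)
      have h2 : twistFun (fun n => d n + c n) x (n + 1) = x (n + 1) + (d n + c n) := if_pos hx
      rw [h1, h2, hd, add_assoc]
    · have hd : twistFun d x (n + 1) = x (n + 1) := if_neg hx
      have h1 : twistFun c (twistFun d x) (n + 1) = twistFun d x (n + 1) :=
        if_neg (fun h' => hx (h.1 h'))
      have h2 : twistFun (fun n => d n + c n) x (n + 1) = x (n + 1) := if_neg hx
      rw [h1, h2, hd]

theorem twistFun_zero (x : Pt) : twistFun (fun _ => 0) x = x := by
  funext m
  cases m <;> simp [twistFun]

/-- `twistFun c` as a permutation. It acts on each `W n` as the power `b ^ c n` of the generator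
`b` below, see `twist_eq_pow`. -/
def twist (c : ℕ → ZMod 3) : Equiv.Perm Pt where
  toFun := twistFun c
  invFun := twistFun (fun n => -c n)
  left_inv x := by
    rw [twistFun_twistFun]
    simpa using twistFun_zero x
  right_inv x := by
    rw [twistFun_twistFun]
    simpa using twistFun_zero x

/-- The generator `b = (a, Id, b)` of the Fabrykowski–Gupta group. -/
def b : Equiv.Perm Pt := twist (fun _ => 1)

theorem b_pow (k : ℕ) (x : Pt) : (b ^ k) x = twistFun (fun _ => (k : ZMod 3)) x := by
  induction k with
  | zero => simpa using (twistFun_zero x).symm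
  | succ k ih =>
    rw [pow_succ', Equiv.Perm.mul_apply, ih]
    change twistFun (fun _ => 1) (twistFun (fun _ => (k : ZMod 3)) x) = _
    rw [twistFun_twistFun]
    push_cast
    rfl

theorem twist_eq_pow (c : ℕ → ZMod 3) (n : ℕ) (x : Pt) (hx : x ∈ W n) :
    twist c x = (b ^ (c n).val) x := by
  rw [b_pow, ZMod.natCast_zmod_val]
  change twistFun c x = _
  funext m
  cases m with
  | zero => rfl
  | succ m =>
    by_cases hm : x m = 0 ∧ ∀ k < m, x k = 2
    · have hmn : m = n := by
        rcases lt_trichotomy m n with h | h | h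
        · have h2 := hx.2 m h
          rw [hm.1] at h2
          exact absurd h2 (by decide)
        · exact h
        · have h2 := hm.2 n h
          rw [hx.1] at h2
          exact absurd h2 (by decide)
      subst hmn
      rfl
    · simp only [twistFun, if_neg hm]

/-- Exponents of the first fragment at the connectors `(1), (2), (3), (4)` : `0, 1, 2, 1`.
The four connectors, and the four groups, are indexed by `ZMod 4`, so that `(4)` is `0`. -/
def e₁ : ZMod 4 → ZMod 3 := ![1, 0, 1, 2]

/-- Exponents of the second fragment at the connectors `(1), (2), (3), (4)` : `1, 1, 1, 0`. -/
def e₂ : ZMod 4 → ZMod 3 := ![0, 1, 1, 1]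

/-- The fragment of `b` that acts on `W n` as the power of `b` with exponent `e₁ (i + n)`. -/
def b₁ (i : ZMod 4) : Equiv.Perm Pt := twist (fun n => e₁ (i + n))

/-- The fragment of `b` that acts on `W n` as the power of `b` with exponent `e₂ (i + n)`. -/
def b₂ (i : ZMod 4) : Equiv.Perm Pt := twist (fun n => e₂ (i + n))

/-- The group `H_i` generated by the two fragments of `b`. -/
def H (i : ZMod 4) : Subgroup (Equiv.Perm Pt) := Subgroup.closure {b₁ i, b₂ i}

/-- The group `G_i` generated by `a` and `H_i`. -/
def G (i : ZMod 4) : Subgroup (Equiv.Perm Pt) :=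
  Subgroup.closure ({a} ∪ (H i : Set (Equiv.Perm Pt)))

/-- In `G_i`, the piece belonging to the connector `(j)` is the union of the sets `W n` with
`i + n ≡ j` modulo `4`. -/
def piece (i j : ZMod 4) : Set Pt := ⋃ (n : ℕ) (_ : i + (n : ZMod 4) = j), W n

/-- `h` acts as `b ^ c` on the piece of the connector `(j)` of `G_i`. For `h ∈ H_i` this says that
the `j`-th coordinate of `h` in `(ℤ/3)⁴` is `c`; the connector `(j)` is the Cayley graph of
the image of `H_i` under this coordinate. -/
def ActsAs (i j : ZMod 4) (h : Equiv.Perm Pt) (c : ZMod 3) : Prop :=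
  ∀ x ∈ piece i j, h x = (b ^ c.val) x

/-- The right action of a word `s₁ s₂ ⋯ s_l`: first `s₁`, then `s₂`, and so on. -/
def act (w : List (Equiv.Perm Pt)) (x : Pt) : Pt := w.foldl (fun y s => s y) x

/-- The word `y` ends in the boundary point `0 2 ⋯ 2` (with `k` letters) of the tile of
level `k`. -/
def EndsInEta (k : ℕ) (y : Pt) : Prop := ∀ n < k, y n = if n + 1 = k then 0 else 2

/-- The word `y` ends in the boundary point `2 ⋯ 2` (with `k` letters) of the tile of level `k`. -/
def EndsInXi (k : ℕ) (y : Pt) : Prop := ∀ n < k, y n = 2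

/-- The tile of level `k` inside the orbital graph of `xi`: words that may differ from `… 2 2 2`
only in the last `k` letters. -/
def tile (k : ℕ) : Set Pt := {y | ∀ n, k ≤ n → y n = 2}

/-- The bridge of rank `k` inside the orbital graph of a word with tail `u`, around the connector
at the words ending in `0 2 ⋯ 2` with `m ≥ k` letters `2`. Its three copies of the tile
of level `k` are given by the letter with index `m + 1`; they are joined to one another at
the words ending in `2 ⋯ 2` (`k` letters). -/
def bridge (k m : ℕ) (u : Pt) : Set Pt :=
  {y | (∀ n, k ≤ n → n < m → y n = 2) ∧ y m = 0 ∧ ∀ n, m + 2 ≤ n → y n = u n}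

/-- The walk of the word `w` from `z` stays in `B`, it starts and ends at the boundary point
`0 2 ⋯ 2` of a copy of the tile of level `k` in `B` and does not touch
such boundary points in between, and it passes through a boundary point `2 ⋯ 2`, where
the copies of the tile are joined. -/
structure IsTraverse (k : ℕ) (B : Set Pt) (w : List (Equiv.Perm Pt)) (z : Pt) : Prop where
  stays : ∀ j ≤ w.length, act (w.take j) z ∈ B
  starts : EndsInEta k z
  ends : EndsInEta k (act w z)
  inside : ∀ j, 0 < j → j < w.length → ¬ EndsInEta k (act (w.take j) z)
  crosses : ∃ j ≤ w.length, EndsInXi k (act (w.take j) z)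

/-- The germ of `f` at `xi` lies in the branch of `h` of the graph of germs: near `xi`, the map `f`
is `h` followed by a change of a fixed number of letters on the right. -/
def InBranch (f : Pt → Pt) (h : Equiv.Perm Pt) : Prop :=
  ∃ k : ℕ, ∀ᶠ x in 𝓝 xi, ∀ n, k ≤ n → f x n = h x n

/-- The word `w`, in the letters `⟨a⟩ ∪ H_i`, is a rank `k` traverse of type `h`: it performs
a traverse of the tile of level `k` in the orbital graph of `xi`, and its lift to the graph of
germs of `G_i` at `xi`, whose vertices are the germs of elements of `G_i` at `xi`, goes from
the branch of the identity (from the germ of `t`) to the branch of `h`. -/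
def IsTraverseOfType (i : ZMod 4) (k : ℕ) (w : List (Equiv.Perm Pt)) (h : Equiv.Perm Pt) : Prop :=
  (∀ s ∈ w, s ∈ Subgroup.zpowers a ∨ s ∈ H i) ∧
  ∃ t ∈ G i, InBranch t 1 ∧ IsTraverse k (tile k) w (t xi) ∧ InBranch (fun x => act w (t x)) h

/-- The word `w` is a rank `k` traverse passing through the connector `(j)` of `G_i`, of type `c`:
on every bridge of rank `k` with connector `(j)`, from every copy of the tile, it performs
a traverse, which leads from the copy with letter `y` to the copy with letter `y + c`.
For `c = 0` this is a traverse of type `Id`: it comes back to the copy where it started. -/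
def PassesConnector (i : ZMod 4) (k : ℕ) (j : ZMod 4) (w : List (Equiv.Perm Pt)) (c : ZMod 3) :
    Prop :=
  ∀ m : ℕ, k ≤ m → i + (m : ZMod 4) = j → ∀ u z : Pt, z ∈ bridge k m u → EndsInEta k z →
    IsTraverse k (bridge k m u) w z ∧ act w z = Function.update z (m + 1) (z (m + 1) + c)

/-- The growth function of a group with respect to `S`: the number of elements that are products
of at most `R` elements of `S`. -/
def growth {Γ : Type*} [Group Γ] (S : Set Γ) (R : ℝ) : ℕ :=
  Set.ncard {g : Γ | ∃ l : List Γ, (∀ s ∈ l, s ∈ S) ∧ l.prod = g ∧ (l.length : ℝ) ≤ R}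

/-- Domination of growth functions. -/
def Dominated (f₁ f₂ : ℝ → ℝ) : Prop :=
  ∃ C : ℝ, 1 ≤ C ∧ ∀ R : ℝ, 1 ≤ R → f₁ R ≤ f₂ (C * R)

end FabrykowskiGupta

end

/-! The elements of `H i` are the `frag i p q`, whose coordinates `coord p q j` are the values of a
linear form at the vectors `(e₁ j, e₂ j)`. These four vectors span the four lines of `(ℤ/3)²`, so a
nonzero form vanishes at exactly one of them. Every piece accumulates at `xi`, so the germ of a
fragment at `xi` remembers all its coordinates (`frag_eq_of_eventually`). The claims on germs follow
by multiplying letters one at a time (`exists_isGerm`).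

For traverses, the same word is run in the tile at `xi` and in a bridge (`Follows`). Both walks show
the same last `k` letters. The branch and the copy can change only when these letters are all `2`: a
fragment used there adds its exponents to the branch and its coordinate at the connector to the
letter labelling the copy. Hence the total shift between copies is a coordinate of the final branch,
and a nontrivial branch has one vanishing coordinate.

The growth estimate rests on a weighted length that contracts after one level: the sections of an
element of weight `n` have total weight at most `9/10 * (n + 36)` (`Ball.exists_sections`). This
bounds the size of a ball by products of sizes of smaller balls (`card_ballFinset_le`). By concavity
the bound `exp (C * (n + 1) ^ β)` propagates once `3 ^ (1 - β) * (9/10) ^ β < 1`. The value `β =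
11/12` qualifies and lies below the required exponent `0.9197…`, so `η` enters only through a
numerical comparison. -/

namespace FabrykowskiGupta

/-! ### The action of `a` and of the twists -/

@[simp] theorem snoc_zero (v : Pt) (y : ZMod 3) : snoc v y 0 = y := rfl

@[simp] theorem snoc_succ (v : Pt) (y : ZMod 3) (n : ℕ) : snoc v y (n + 1) = v n := rfl

theorem snoc_tail (x : Pt) : snoc (fun n => x (n + 1)) (x 0) = x := by
  funext n
  cases n <;> rfl

theorem a_snoc (v : Pt) (y : ZMod 3) : a (snoc v y) = snoc v (y + 1) := rfl

theorem a_pow_apply_zero (k : ℕ) (x : Pt) : (a ^ k) x 0 = x 0 + k := by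
  induction k with
  | zero => simp
  | succ k ih =>
    rw [pow_succ', Equiv.Perm.mul_apply]
    change (a ^ k) x 0 + 1 = _
    rw [ih]
    push_cast
    ring

theorem a_pow_apply_succ (k : ℕ) (x : Pt) (n : ℕ) : (a ^ k) x (n + 1) = x (n + 1) := by
  induction k with
  | zero => simp
  | succ k ih =>
    rw [pow_succ', Equiv.Perm.mul_apply]
    exact ih

theorem a_pow_snoc (k : ℕ) (v : Pt) (y : ZMod 3) : (a ^ k) (snoc v y) = snoc v (y + k) := by
  funext n
  cases n with
  | zero => exact a_pow_apply_zero k _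
  | succ n => exact a_pow_apply_succ k _ n

/-- The powers of `a`, indexed by their exponent modulo `3`. -/
def rot (e : ZMod 3) : Equiv.Perm Pt := a ^ e.val

theorem rot_snoc (e : ZMod 3) (v : Pt) (y : ZMod 3) : rot e (snoc v y) = snoc v (y + e) := by
  rw [rot, a_pow_snoc, ZMod.natCast_zmod_val]

theorem rot_apply_zero (e : ZMod 3) (x : Pt) : rot e x 0 = x 0 + e := by
  rw [rot, a_pow_apply_zero, ZMod.natCast_zmod_val]

theorem rot_apply_succ (e : ZMod 3) (x : Pt) (n : ℕ) : rot e x (n + 1) = x (n + 1) :=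
  a_pow_apply_succ _ x n

theorem rot_mul (e f : ZMod 3) : rot e * rot f = rot (e + f) := by
  ext x n
  cases n with
  | zero => rw [Equiv.Perm.mul_apply, rot_apply_zero, rot_apply_zero, rot_apply_zero]; ring
  | succ n => rw [Equiv.Perm.mul_apply, rot_apply_succ, rot_apply_succ, rot_apply_succ]

@[simp] theorem rot_zero : rot 0 = 1 := by simp [rot]

theorem rot_one : rot 1 = a := by
  rw [rot, show (1 : ZMod 3).val = 1 from rfl, pow_one]

theorem exists_rot_of_mem_zpowers {s : Equiv.Perm Pt} (hs : s ∈ Subgroup.zpowers a) :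
    ∃ e, s = rot e := by
  obtain ⟨k, rfl⟩ := Subgroup.mem_zpowers_iff.1 hs
  induction k using Int.induction_on with
  | zero => exact ⟨0, by simp⟩
  | succ k ih =>
    obtain ⟨e, he⟩ := ih (Subgroup.zpow_mem _ (Subgroup.mem_zpowers a) _)
    exact ⟨e + 1, by rw [zpow_add_one, he, ← rot_one, rot_mul]⟩
  | pred k ih =>
    obtain ⟨e, he⟩ := ih (Subgroup.zpow_mem _ (Subgroup.mem_zpowers a) _)
    refine ⟨e + 2, ?_⟩
    have h2 : a⁻¹ = rot 2 := by
      rw [inv_eq_iff_mul_eq_one, ← rot_one, rot_mul, show (1 + 2 : ZMod 3) = 0 from rfl, rot_zero]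
    rw [zpow_sub_one, he, h2, rot_mul]

theorem eq_of_mem_W {x : Pt} {m n : ℕ} (hm : x ∈ W m) (hn : x ∈ W n) : m = n := by
  have h20 : (2 : ZMod 3) ≠ 0 := by decide
  rcases lt_trichotomy m n with h | h | h
  · exact absurd ((hn.2 m h).symm.trans hm.1) h20
  · exact h
  · exact absurd ((hm.2 n h).symm.trans hn.1) h20

theorem twist_apply (c : ℕ → ZMod 3) (x : Pt) : twist c x = twistFun c x := rfl

open Classical in
theorem twist_apply_succ (c : ℕ → ZMod 3) (x : Pt) (n : ℕ) :
    twist c x (n + 1) = if x ∈ W n then x (n + 1) + c n else x (n + 1) := by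
  rw [twist_apply]
  by_cases hx : x ∈ W n
  · rw [if_pos hx]; exact if_pos hx
  · rw [if_neg hx]; exact if_neg hx

theorem twist_apply_of_mem_W {c : ℕ → ZMod 3} {x : Pt} {n : ℕ} (hx : x ∈ W n) :
    twist c x = Function.update x (n + 1) (x (n + 1) + c n) := by
  funext m
  cases m with
  | zero => rfl
  | succ m =>
    rw [twist_apply_succ]
    by_cases hm : m = n
    · subst hm
      rw [if_pos hx, Function.update_self]
    · rw [if_neg (fun h => hm (eq_of_mem_W h hx)), Function.update_of_ne (by omega)]

theorem twist_apply_of_notMem {c : ℕ → ZMod 3} {x : Pt} (hx : ∀ n, x ∉ W n) : twist c x = x := by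
  funext m
  cases m with
  | zero => rfl
  | succ m => rw [twist_apply_succ, if_neg (hx m)]

theorem xi_notMem_W (n : ℕ) : xi ∉ W n := fun h => absurd h.1 (by decide : (2 : ZMod 3) ≠ 0)

theorem twist_xi (c : ℕ → ZMod 3) : twist c xi = xi := twist_apply_of_notMem xi_notMem_W

theorem snoc_mem_W_zero {v : Pt} {y : ZMod 3} : snoc v y ∈ W 0 ↔ y = 0 := by
  simp [W]

theorem snoc_mem_W_succ {v : Pt} {y : ZMod 3} {n : ℕ} :
    snoc v y ∈ W (n + 1) ↔ y = 2 ∧ v ∈ W n := by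
  constructor
  · rintro ⟨h0, h⟩
    exact ⟨h 0 (by omega), h0, fun k hk => h (k + 1) (by omega)⟩
  · rintro ⟨hy, h0, h⟩
    refine ⟨h0, fun k hk => ?_⟩
    cases k with
    | zero => exact hy
    | succ k => exact h k (by omega)

theorem twist_snoc_zero (c : ℕ → ZMod 3) (v : Pt) :
    twist c (snoc v 0) = snoc (rot (c 0) v) 0 := by
  rw [twist_apply_of_mem_W (snoc_mem_W_zero.2 rfl)]
  funext m
  rcases m with _ | _ | m
  · rfl
  · simp [rot_apply_zero]
  · simp [rot_apply_succ]

theorem twist_snoc_one (c : ℕ → ZMod 3) (v : Pt) : twist c (snoc v 1) = snoc v 1 := by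
  apply twist_apply_of_notMem
  rintro (_ | n) h
  · exact absurd (snoc_mem_W_zero.1 h) (by decide)
  · exact absurd (snoc_mem_W_succ.1 h).1 (by decide)

theorem twist_snoc_two (c : ℕ → ZMod 3) (v : Pt) :
    twist c (snoc v 2) = snoc (twist (fun n => c (n + 1)) v) 2 := by
  funext m
  rcases m with _ | _ | m
  · rfl
  · have h20 : (2 : ZMod 3) ≠ 0 := by decide
    rw [twist_apply_succ, if_neg (by rw [snoc_mem_W_zero]; exact h20)]
    rfl
  · rw [twist_apply_succ, snoc_succ, snoc_succ, twist_apply_succ]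
    classical exact if_congr (snoc_mem_W_succ.trans (and_iff_right rfl)) rfl rfl

/-! ### The fragments of `b` -/

/-- The `j`-th coordinate of the element of `H_i` with exponents `p` and `q`. -/
def coord (p q : ZMod 3) (j : ZMod 4) : ZMod 3 := p * e₁ j + q * e₂ j

/-- The element of `H_i` with exponents `p` and `q`. -/
def frag (i : ZMod 4) (p q : ZMod 3) : Equiv.Perm Pt := twist (fun n => coord p q (i + n))

theorem coord_add (p q p' q' : ZMod 3) (j : ZMod 4) :
    coord (p + p') (q + q') j = coord p q j + coord p' q' j := by
  simp only [coord]; ring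

theorem eq_of_coord_eq {p q p' q' : ZMod 3} (h : ∀ j, coord p q j = coord p' q' j) :
    p = p' ∧ q = q' := by
  revert h
  revert p q p' q'
  decide

/-- The vectors `(e₁ j, e₂ j)` represent each line of `(ℤ/3)²` once, and the kernel of a nonzero
linear form is exactly one line. -/
theorem existsUnique_coord_eq_zero {p q : ZMod 3} (h : ¬(p = 0 ∧ q = 0)) :
    ∃! j, coord p q j = 0 := by
  have key : ∀ p q : ZMod 3, ¬(p = 0 ∧ q = 0) →
      ∃ j, coord p q j = 0 ∧ ∀ j', coord p q j' = 0 → j' = j := by decide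
  exact key p q h

theorem b₁_eq_frag (i : ZMod 4) : b₁ i = frag i 1 0 := by
  simp [b₁, frag, coord]

theorem b₂_eq_frag (i : ZMod 4) : b₂ i = frag i 0 1 := by
  simp [b₂, frag, coord]

theorem frag_mul (i : ZMod 4) (p q p' q' : ZMod 3) :
    frag i p q * frag i p' q' = frag i (p + p') (q + q') := by
  ext x : 1
  rw [Equiv.Perm.mul_apply, frag, frag, frag, twist_apply, twist_apply, twist_apply,
    twistFun_twistFun]
  congr 1
  funext n
  rw [coord_add, add_comm]

@[simp] theorem frag_zero (i : ZMod 4) : frag i 0 0 = 1 := by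
  ext x : 1
  simpa [frag, coord, twist_apply] using twistFun_zero x

theorem frag_xi (i : ZMod 4) (p q : ZMod 3) : frag i p q xi = xi := twist_xi _

theorem frag_apply_of_mem_W {i : ZMod 4} {p q : ZMod 3} {x : Pt} {n : ℕ} (hx : x ∈ W n) :
    frag i p q x = Function.update x (n + 1) (x (n + 1) + coord p q (i + n)) :=
  twist_apply_of_mem_W hx

theorem frag_snoc_zero (i : ZMod 4) (p q : ZMod 3) (v : Pt) :
    frag i p q (snoc v 0) = snoc (rot (coord p q i) v) 0 := by
  rw [frag, twist_snoc_zero]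
  simp

theorem frag_snoc_one (i : ZMod 4) (p q : ZMod 3) (v : Pt) :
    frag i p q (snoc v 1) = snoc v 1 := twist_snoc_one _ v

theorem frag_snoc_two (i : ZMod 4) (p q : ZMod 3) (v : Pt) :
    frag i p q (snoc v 2) = snoc (frag (i + 1) p q v) 2 := by
  rw [frag, twist_snoc_two, frag]
  congr 3
  funext n
  congr 1
  push_cast
  ring

/-- The elements of `H_i` as a homomorphic image of `(ℤ/3)²`. -/
def fragHom (i : ZMod 4) : Multiplicative (ZMod 3 × ZMod 3) →* Equiv.Perm Pt where
  toFun z := frag i z.toAdd.1 z.toAdd.2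
  map_one' := frag_zero i
  map_mul' _ _ := (frag_mul i _ _ _ _).symm

theorem frag_mem_H (i : ZMod 4) (p q : ZMod 3) : frag i p q ∈ H i := by
  have h1 : frag i 1 0 ∈ H i := b₁_eq_frag i ▸ Subgroup.subset_closure (by simp)
  have h2 : frag i 0 1 ∈ H i := b₂_eq_frag i ▸ Subgroup.subset_closure (by simp)
  have hp : ∀ k : ℕ, frag i k 0 ∈ H i := by
    intro k
    induction k with
    | zero => simp
    | succ k ih => simpa [frag_mul] using (H i).mul_mem ih h1
  have hq : ∀ k : ℕ, frag i 0 k ∈ H i := by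
    intro k
    induction k with
    | zero => simp
    | succ k ih => simpa [frag_mul] using (H i).mul_mem ih h2
  simpa [frag_mul] using (H i).mul_mem (hp p.val) (hq q.val)

theorem range_fragHom (i : ZMod 4) : (fragHom i).range = H i := by
  apply le_antisymm
  · rintro _ ⟨z, rfl⟩
    exact frag_mem_H i _ _
  · refine (Subgroup.closure_le _).2 ?_
    rintro s (rfl | rfl)
    · exact ⟨Multiplicative.ofAdd (1, 0), (b₁_eq_frag i).symm⟩
    · exact ⟨Multiplicative.ofAdd (0, 1), (b₂_eq_frag i).symm⟩

theorem mem_H_iff {i : ZMod 4} {h : Equiv.Perm Pt} : h ∈ H i ↔ ∃ p q, h = frag i p q := by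
  constructor
  · intro hh
    rw [← range_fragHom] at hh
    obtain ⟨z, rfl⟩ := hh
    exact ⟨_, _, rfl⟩
  · rintro ⟨p, q, rfl⟩
    exact frag_mem_H i p q

/-- The word `… 2 2 0 2 ⋯ 2` in `W n`. -/
def zeroAt (n : ℕ) : Pt := Function.update xi n 0

theorem zeroAt_of_ne {n m : ℕ} (h : m ≠ n) : zeroAt n m = 2 := by
  rw [zeroAt, Function.update_of_ne h, xi]

theorem zeroAt_mem_W (n : ℕ) : zeroAt n ∈ W n :=
  ⟨by simp [zeroAt], fun _ hk => zeroAt_of_ne hk.ne⟩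

/-- The lower bound `N` provides points of each piece arbitrarily close to `xi`. -/
theorem exists_index (i j : ZMod 4) (N : ℕ) : ∃ n, N ≤ n ∧ i + (n : ZMod 4) = j := by
  refine ⟨(j - i).val + 4 * N, by omega, ?_⟩
  have h4 : ((4 : ℕ) : ZMod 4) = 0 := rfl
  push_cast
  rw [ZMod.natCast_zmod_val]
  have : (4 : ZMod 4) = 0 := h4
  rw [this]
  ring

theorem b_pow_val_eq_twist (c : ZMod 3) : b ^ c.val = twist (fun _ => c) := by
  ext x : 1
  rw [b_pow, ZMod.natCast_zmod_val, twist_apply]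

theorem actsAs_frag_iff {i j : ZMod 4} {p q c : ZMod 3} :
    ActsAs i j (frag i p q) c ↔ c = coord p q j := by
  constructor
  · intro h
    obtain ⟨n, -, hn⟩ := exists_index i j 0
    have hz : zeroAt n ∈ piece i j := Set.mem_iUnion₂.2 ⟨n, hn, zeroAt_mem_W n⟩
    have h1 := congrFun (h _ hz) (n + 1)
    rw [b_pow_val_eq_twist, twist_apply_of_mem_W (zeroAt_mem_W n),
      frag_apply_of_mem_W (zeroAt_mem_W n), hn] at h1
    simpa using h1.symm
  · rintro rfl x hx
    obtain ⟨n, hn, hxn⟩ := Set.mem_iUnion₂.1 hx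
    rw [b_pow_val_eq_twist, twist_apply_of_mem_W hxn, frag_apply_of_mem_W hxn, hn]

theorem frag_inj {i : ZMod 4} {p q p' q' : ZMod 3} (h : frag i p q = frag i p' q') :
    p = p' ∧ q = q' := by
  apply eq_of_coord_eq
  intro j
  rw [← actsAs_frag_iff (i := i), ← h, actsAs_frag_iff]

theorem nonempty_H_equiv (i : ZMod 4) :
    Nonempty (H i ≃* Multiplicative (ZMod 3 × ZMod 3)) := by
  have hinj : Function.Injective (fragHom i) := by
    intro z z' h
    obtain ⟨h1, h2⟩ := frag_inj h
    exact Multiplicative.toAdd.injective (Prod.ext h1 h2)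
  exact ⟨((MonoidHom.ofInjective hinj).trans
    (MulEquiv.subgroupCongr (range_fragHom i))).symm⟩

theorem frag_eq_one_iff {i : ZMod 4} {p q : ZMod 3} : frag i p q = 1 ↔ p = 0 ∧ q = 0 := by
  constructor
  · intro h
    exact frag_inj (h.trans (frag_zero i).symm)
  · rintro ⟨rfl, rfl⟩
    exact frag_zero i

/-- Since `b` moves every point of every `W n`, its fixed points lie outside all of them, where each
twist is trivial. -/
theorem frag_apply_of_b_apply_eq {i : ZMod 4} {p q : ZMod 3} {x : Pt} (hx : b x = x) :
    frag i p q x = x := by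
  apply twist_apply_of_notMem
  intro n hn
  have h := congrFun hx (n + 1)
  rw [b, twist_apply_of_mem_W hn, Function.update_self] at h
  exact absurd (left_eq_add.1 h.symm) (by decide)

theorem frag_isUnique_coord {i : ZMod 4} {h : Equiv.Perm Pt} (hh : h ∈ H i) (h1 : h ≠ 1) :
    ∃! j : ZMod 4, ActsAs i j h 0 := by
  obtain ⟨p, q, rfl⟩ := mem_H_iff.1 hh
  simp only [actsAs_frag_iff, eq_comm (a := (0 : ZMod 3))]
  exact existsUnique_coord_eq_zero (fun h0 => h1 (frag_eq_one_iff.2 h0))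

/-! ### Induction on the elements of `G i` -/

theorem rot_mem_G (i : ZMod 4) (e : ZMod 3) : rot e ∈ G i :=
  (G i).pow_mem (Subgroup.subset_closure (by simp)) _

theorem frag_mem_G (i : ZMod 4) (p q : ZMod 3) : frag i p q ∈ G i :=
  Subgroup.subset_closure (Or.inr (frag_mem_H i p q))

/-- Inverses need no case of their own, because the powers of `a` and the fragments are each closed
under inversion. -/
theorem G_induction {i : ZMod 4} {motive : Equiv.Perm Pt → Prop} (one : motive 1)
    (rot_mul : ∀ e g, g ∈ G i → motive g → motive (rot e * g))
    (frag_mul : ∀ p q g, g ∈ G i → motive g → motive (frag i p q * g))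
    {g : Equiv.Perm Pt} (hg : g ∈ G i) : motive g := by
  have hH : ∀ x ∈ H i, ∀ y ∈ G i, motive y → motive (x * y) := by
    intro x hx y hy h
    obtain ⟨p, q, rfl⟩ := mem_H_iff.1 hx
    exact frag_mul p q y hy h
  have ha : ∀ x ∈ Subgroup.zpowers a, ∀ y ∈ G i, motive y → motive (x * y) := by
    intro x hx y hy h
    obtain ⟨e, rfl⟩ := exists_rot_of_mem_zpowers hx
    exact rot_mul e y hy h
  induction hg using Subgroup.closure_induction_left with
  | one => exact one
  | mul_left x hx y hy ih =>
    rcases hx with hx | hx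
    · rw [Set.mem_singleton_iff.1 hx]
      exact ha a (Subgroup.mem_zpowers a) y hy ih
    · exact hH x hx y hy ih
  | inv_mul_cancel x hx y hy ih =>
    rcases hx with hx | hx
    · rw [Set.mem_singleton_iff.1 hx]
      exact ha _ (inv_mem (Subgroup.mem_zpowers a)) y hy ih
    · exact hH _ (inv_mem hx) y hy ih

theorem letter_cases : ∀ y : ZMod 3, y = 0 ∨ y = 1 ∨ y = 2 := by decide

theorem exists_section {i : ZMod 4} {g : Equiv.Perm Pt} (hg : g ∈ G i) (y : ZMod 3) :
    ∃ y' : ZMod 3, ∃ g' ∈ G (i + 1), ∀ v : Pt, g (snoc v y) = snoc (g' v) y' := by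
  refine G_induction (motive := fun g => ∃ y' : ZMod 3, ∃ g' ∈ G (i + 1),
    ∀ v : Pt, g (snoc v y) = snoc (g' v) y') ?_ ?_ ?_ hg
  · exact ⟨y, 1, one_mem _, fun _ => rfl⟩
  · intro e g _ ih
    obtain ⟨y', g', hg', h⟩ := ih
    exact ⟨y' + e, g', hg', fun v => by rw [Equiv.Perm.mul_apply, h, rot_snoc]⟩
  · intro p q g _ ih
    obtain ⟨y', g', hg', h⟩ := ih
    have hy := letter_cases y'
    rcases hy with rfl | rfl | rfl
    · exact ⟨0, rot (coord p q i) * g', mul_mem (rot_mem_G _ _) hg',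
        fun v => by rw [Equiv.Perm.mul_apply, h, frag_snoc_zero]; rfl⟩
    · exact ⟨1, g', hg', fun v => by rw [Equiv.Perm.mul_apply, h, frag_snoc_one]⟩
    · exact ⟨2, frag (i + 1) p q * g', mul_mem (frag_mem_G _ _ _) hg',
        fun v => by rw [Equiv.Perm.mul_apply, h, frag_snoc_two]; rfl⟩

/-! ### Germs at `xi` -/

theorem eventually_nhds_xi {P : Pt → Prop} :
    (∀ᶠ x in 𝓝 xi, P x) ↔ ∃ N : ℕ, ∀ x : Pt, (∀ n < N, x n = 2) → P x := by
  constructor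
  · intro h
    rw [nhds_pi, Filter.eventually_iff, Filter.mem_pi] at h
    obtain ⟨I, hI, t, ht, hsub⟩ := h
    obtain ⟨N, hN⟩ := hI.bddAbove
    refine ⟨N + 1, fun x hx => hsub ?_⟩
    intro n hn
    rw [hx n (Nat.lt_succ_of_le (hN hn))]
    exact mem_of_mem_nhds (ht n)
  · rintro ⟨N, h⟩
    have : ∀ᶠ x in 𝓝 xi, ∀ n ∈ Finset.range N, x n = 2 := by
      rw [Filter.eventually_all_finset]
      intro n _
      have hc : Tendsto (fun x : Pt => x n) (𝓝 xi) (𝓝 (xi n)) := (continuous_apply n).tendsto _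
      rw [nhds_discrete (ZMod 3)] at hc
      exact tendsto_pure.1 hc
    filter_upwards [this] with x hx
    exact h x (fun n hn => hx n (Finset.mem_range.2 hn))

/-- On the words that end in `K` letters `2`, the map `f` is `h` in front of the last `K` letters,
and it replaces the last `K` letters by those of `f xi`. -/
def IsGerm (K : ℕ) (f : Pt → Pt) (h : Equiv.Perm Pt) : Prop :=
  ∀ x : Pt, (∀ n < K, x n = 2) → (∀ n, K ≤ n → f x n = h x n) ∧ ∀ n < K, f x n = f xi n

/-- A fragment changes only the letter that follows a `0`. After `K` letters `2` this letter has
index at least `K + 1`, so index `K` is still safe. -/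
theorem frag_apply_of_le {i : ZMod 4} {p q : ZMod 3} {x : Pt} {K : ℕ} (hx : ∀ n < K, x n = 2)
    {n : ℕ} (hn : n ≤ K) : frag i p q x n = x n := by
  cases n with
  | zero => rfl
  | succ n =>
    have h20 : (2 : ZMod 3) ≠ 0 := by decide
    rw [frag, twist_apply_succ, if_neg]
    intro h
    exact h20 ((hx n (by omega)).symm.trans h.1)

theorem IsGerm.mono {K K' : ℕ} (hK : K ≤ K') {f : Pt → Pt} {i : ZMod 4} {p q : ZMod 3}
    (h : IsGerm K f (frag i p q)) : IsGerm K' f (frag i p q) := by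
  intro x hx
  have h1 := h x (fun n hn => hx n (by omega))
  have h2 := h xi (fun n hn => rfl)
  refine ⟨fun n hn => h1.1 n (by omega), fun n hn => ?_⟩
  rcases lt_or_ge n K with hnK | hnK
  · exact h1.2 n hnK
  · rw [h1.1 n hnK, h2.1 n hnK, frag_xi, frag_apply_of_le hx hn.le, hx n hn, xi]

theorem IsGerm.rot_comp {K : ℕ} (hK : 1 ≤ K) {f : Pt → Pt} {h : Equiv.Perm Pt}
    (hf : IsGerm K f h) (e : ZMod 3) : IsGerm K (fun x => rot e (f x)) h := by
  intro x hx
  obtain ⟨h1, h2⟩ := hf x hx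
  refine ⟨fun n hn => ?_, fun n hn => ?_⟩
  · obtain ⟨m, rfl⟩ : ∃ m, n = m + 1 := ⟨n - 1, by omega⟩
    simp only [rot_apply_succ]
    exact h1 _ hn
  · cases n with
    | zero => simp only [rot_apply_zero]; rw [h2 0 hn]
    | succ n => simp only [rot_apply_succ]; exact h2 _ hn

/-- Following a germ at `xi` by a fragment at a point other than `xi`. -/
theorem IsGerm.frag_comp_of_ne {K : ℕ} {f : Pt → Pt} {h : Equiv.Perm Pt} (hf : IsGerm K f h)
    (i : ZMod 4) (p q : ZMod 3) {m : ℕ} (hm : m + 1 < K) (hne : f xi m ≠ 2) :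
    IsGerm K (fun x => frag i p q (f x)) h := by
  intro x hx
  obtain ⟨h1, h2⟩ := hf x hx
  have hW : ∀ n, n + 1 < K → (f x ∈ W n ↔ f xi ∈ W n) := by
    intro n hn
    constructor
    · rintro ⟨h0, h3⟩
      exact ⟨by rw [← h2 n (by omega)]; exact h0,
        fun k hk => by rw [← h2 k (by omega)]; exact h3 k hk⟩
    · rintro ⟨h0, h3⟩
      exact ⟨by rw [h2 n (by omega)]; exact h0,
        fun k hk => by rw [h2 k (by omega)]; exact h3 k hk⟩
  refine ⟨fun n hn => ?_, fun n hn => ?_⟩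
  · obtain ⟨n, rfl⟩ : ∃ m, n = m + 1 := ⟨n - 1, by omega⟩
    rw [← h1 _ hn]
    simp only [frag]
    -- The letter `m` of `f x` is not `2`, so `f x ∈ W n` forces `n ≤ m`, and the changed letter has
    -- index at most `m + 1 < K`.
    rw [twist_apply_succ, if_neg]
    intro hw
    exact hne ((h2 m (by omega)).symm.trans (hw.2 m (by omega)))
  · cases n with
    | zero => exact h2 0 hn
    | succ n =>
      simp only [frag]
      rw [twist_apply_succ, twist_apply_succ, h2 _ hn]
      classical exact if_congr (hW n hn) rfl rfl

/-- Following a germ at `xi` that fixes `xi` by a fragment. -/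
theorem IsGerm.frag_comp_of_eq {K : ℕ} {f : Pt → Pt} {i : ZMod 4} {p q : ZMod 3}
    (hf : IsGerm K f (frag i p q)) (hxi : f xi = xi) (p' q' : ZMod 3) :
    IsGerm K (fun x => frag i p' q' (f x)) (frag i (p' + p) (q' + q)) := by
  intro x hx
  obtain ⟨h1, h2⟩ := hf x hx
  have hfx : f x = frag i p q x := by
    funext n
    rcases lt_or_ge n K with hn | hn
    · rw [h2 n hn, hxi, frag_apply_of_le hx hn.le, hx n hn, xi]
    · exact h1 n hn
  have hmul : frag i p' q' (f x) = frag i (p' + p) (q' + q) x := by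
    rw [hfx, ← frag_mul, Equiv.Perm.mul_apply]
  refine ⟨fun n _ => congrFun hmul n, fun n hn => ?_⟩
  simp only [hmul, hxi, frag_xi]
  rw [frag_apply_of_le hx hn.le, hx n hn, xi]

theorem exists_isGerm {i : ZMod 4} {g : Equiv.Perm Pt} (hg : g ∈ G i) :
    ∃ K p q, IsGerm K g (frag i p q) := by
  refine G_induction (motive := fun g => ∃ K p q, IsGerm K g (frag i p q)) ?_ ?_ ?_ hg
  · exact ⟨0, 0, 0, fun x _ => ⟨fun n _ => by simp, fun n hn => by omega⟩⟩
  · intro e g _ ih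
    obtain ⟨K, p, q, h⟩ := ih
    exact ⟨K + 1, p, q, (h.mono (Nat.le_succ K)).rot_comp (by omega) e⟩
  · intro p' q' g _ ih
    obtain ⟨K, p, q, h⟩ := ih
    by_cases hxi : g xi = xi
    · exact ⟨K, _, _, h.frag_comp_of_eq hxi p' q'⟩
    · obtain ⟨m, hm⟩ := Function.ne_iff.1 hxi
      exact ⟨max K (m + 2), p, q,
        (h.mono (le_max_left _ _)).frag_comp_of_ne i p' q' (by omega) hm⟩

theorem IsGerm.inBranch {K : ℕ} {f : Pt → Pt} {h : Equiv.Perm Pt} (hf : IsGerm K f h) :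
    InBranch f h :=
  ⟨K, eventually_nhds_xi.2 ⟨K, fun x hx => (hf x hx).1⟩⟩

/-- The words `zeroAt n` tend to `xi`, and the letter `n + 1` of their images reveals the coordinate
at `i + n`. -/
theorem frag_eq_of_eventually {i : ZMod 4} {p q p' q' : ZMod 3} {k : ℕ}
    (h : ∀ᶠ x in 𝓝 xi, ∀ n, k ≤ n → frag i p q x n = frag i p' q' x n) :
    p = p' ∧ q = q' := by
  obtain ⟨N, hN⟩ := eventually_nhds_xi.1 h
  apply eq_of_coord_eq
  intro j
  obtain ⟨n, hn, hj⟩ := exists_index i j (max k N)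
  have h1 := hN (zeroAt n) (fun m hm => zeroAt_of_ne (by omega)) (n + 1) (by omega)
  rw [frag_apply_of_mem_W (zeroAt_mem_W n), frag_apply_of_mem_W (zeroAt_mem_W n),
    Function.update_self, Function.update_self, hj] at h1
  exact add_left_cancel h1

theorem InBranch.unique {f : Pt → Pt} {i : ZMod 4} {p q p' q' : ZMod 3}
    (h : InBranch f (frag i p q)) (h' : InBranch f (frag i p' q')) : p = p' ∧ q = q' := by
  obtain ⟨k, hk⟩ := h
  obtain ⟨k', hk'⟩ := h'
  apply frag_eq_of_eventually (i := i) (k := max k k')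
  filter_upwards [hk, hk'] with x hx hx' n hn
  rw [← hx n (by omega), hx' n (by omega)]

theorem existsUnique_inBranch {i : ZMod 4} {g : Equiv.Perm Pt} (hg : g ∈ G i) :
    ∃! h : Equiv.Perm Pt, h ∈ H i ∧ InBranch g h := by
  obtain ⟨K, p, q, h⟩ := exists_isGerm hg
  refine ⟨frag i p q, ⟨frag_mem_H i p q, h.inBranch⟩, ?_⟩
  rintro h' ⟨hh', hb⟩
  obtain ⟨p', q', rfl⟩ := mem_H_iff.1 hh'
  obtain ⟨rfl, rfl⟩ := h.inBranch.unique hb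
  rfl

theorem existsUnique_germ {i : ZMod 4} {g : Equiv.Perm Pt} (hg : g ∈ G i) (hxi : g xi = xi) :
    ∃! h : Equiv.Perm Pt, h ∈ H i ∧ ∀ᶠ x in 𝓝 xi, g x = h x := by
  obtain ⟨K, p, q, h⟩ := exists_isGerm hg
  refine ⟨frag i p q, ⟨frag_mem_H i p q, eventually_nhds_xi.2 ⟨K, fun x hx => ?_⟩⟩, ?_⟩
  · funext n
    rcases lt_or_ge n K with hn | hn
    · rw [(h x hx).2 n hn, hxi, frag_apply_of_le hx hn.le, hx n hn, xi]
    · exact (h x hx).1 n hn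
  · rintro h' ⟨hh', hb⟩
    obtain ⟨p', q', rfl⟩ := mem_H_iff.1 hh'
    have hb' : InBranch g (frag i p' q') :=
      ⟨0, hb.mono fun x hx n _ => congrFun hx n⟩
    obtain ⟨rfl, rfl⟩ := h.inBranch.unique hb'
    rfl

/-! ### Traverses -/

@[simp] theorem act_nil (x : Pt) : act [] x = x := rfl

theorem act_append_singleton (w : List (Equiv.Perm Pt)) (s : Equiv.Perm Pt) (x : Pt) :
    act (w ++ [s]) x = s (act w x) := by
  simp [act]

theorem endsInEta_iff {k : ℕ} (hk : 1 ≤ k) {y : Pt} :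
    EndsInEta k y ↔ y ∈ W (k - 1) := by
  constructor
  · intro h
    refine ⟨by rw [h (k - 1) (by omega), if_pos (by omega)], fun n hn => ?_⟩
    rw [h n (by omega), if_neg (by omega)]
  · rintro ⟨h0, h2⟩ n hn
    by_cases hnk : n + 1 = k
    · rw [if_pos hnk, ← h0, ← hnk, Nat.add_sub_cancel]
    · rw [if_neg hnk, h2 n (by omega)]

theorem EndsInEta.congr {k : ℕ} {x y : Pt} (h : ∀ n < k, x n = y n) :
    EndsInEta k x ↔ EndsInEta k y :=
  forall₂_congr fun n hn => by rw [h n hn]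

theorem EndsInXi.congr {k : ℕ} {x y : Pt} (h : ∀ n < k, x n = y n) :
    EndsInXi k x ↔ EndsInXi k y :=
  forall₂_congr fun n hn => by rw [h n hn]

theorem EndsInEta.not_endsInXi {k : ℕ} (hk : 1 ≤ k) {y : Pt} (h : EndsInEta k y) :
    ¬ EndsInXi k y := fun h' => by
  have h0 := ((endsInEta_iff hk).1 h).1
  rw [h' (k - 1) (by omega)] at h0
  exact absurd h0 (by decide)

/-! ### Walks in a bridge compared with their lifts to the graph of germs -/

/-- The position `z` of a walk in a bridge that started in `z₀`, compared with the germ `f` that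
the same word has at `xi`. -/
structure Follows (i : ZMod 4) (k K m : ℕ) (z₀ : Pt) (f : Pt → Pt) (z : Pt) (p q : ZMod 3) :
    Prop where
  germ : IsGerm K f (frag i p q)
  tile : f xi ∈ tile k
  agree : ∀ n < k, z n = f xi n
  rest : ∀ n, k ≤ n →
    z n = Function.update z₀ (m + 1) (z₀ (m + 1) + coord p q (i + m)) n

namespace Follows

variable {i : ZMod 4} {k K m : ℕ} {z₀ z u : Pt} {f : Pt → Pt} {p q : ZMod 3}

theorem mem_bridge (h : Follows i k K m z₀ f z p q) (hkm : k ≤ m) (hz₀ : z₀ ∈ bridge k m u) :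
    z ∈ bridge k m u := by
  obtain ⟨h1, h2, h3⟩ := hz₀
  refine ⟨fun n hn hnm => ?_, ?_, fun n hn => ?_⟩
  · rw [h.rest n hn, Function.update_of_ne (by omega), h1 n hn hnm]
  · rw [h.rest m hkm, Function.update_of_ne (by omega), h2]
  · rw [h.rest n (by omega), Function.update_of_ne (by omega), h3 n hn]

theorem rot_step (h : Follows i k K m z₀ f z p q) (hk : 1 ≤ k) (hK : k < K) (e : ZMod 3) :
    Follows i k K m z₀ (fun x => rot e (f x)) (rot e z) p q where
  germ := h.germ.rot_comp (by omega) e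
  tile := by
    intro n hn
    obtain ⟨n, rfl⟩ : ∃ l, n = l + 1 := ⟨n - 1, by omega⟩
    rw [rot_apply_succ]
    exact h.tile _ hn
  agree := by
    intro n hn
    cases n with
    | zero => rw [rot_apply_zero, rot_apply_zero, h.agree 0 hn]
    | succ n => rw [rot_apply_succ, rot_apply_succ, h.agree _ hn]
  rest := by
    intro n hn
    obtain ⟨n, rfl⟩ : ∃ l, n = l + 1 := ⟨n - 1, by omega⟩
    rw [rot_apply_succ]
    exact h.rest _ hn

/-- Away from both boundary points of the tile, some letter before index `k` is not `2` and the last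
`k` letters are not `0 2 ⋯ 2`. The fragment therefore acts inside the last `k` letters, alike on
both walks, and keeps the branch and the copy. -/
theorem frag_step_of_ne (h : Follows i k K m z₀ f z p q) (hk : 1 ≤ k) (hK : k < K)
    (heta : ¬ EndsInEta k (f xi)) (hne : f xi ≠ xi) (p' q' : ZMod 3) :
    Follows i k K m z₀ (fun x => frag i p' q' (f x)) (frag i p' q' z) p q := by
  obtain ⟨l, hl⟩ := Function.ne_iff.1 hne
  have hlk : l < k := by
    by_contra hlk
    exact hl (h.tile l (by omega))
  have hW : ∀ y : Pt, (∀ n < k, y n = f xi n) → ∀ n, k - 1 ≤ n → y ∉ W n := by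
    intro y hy n hn hw
    rcases hn.eq_or_lt with rfl | hn
    · exact heta ((EndsInEta.congr hy).1 ((endsInEta_iff hk).2 hw))
    · exact hl ((hy l hlk).symm.trans (hw.2 l (by omega)))
  have hfix : ∀ y : Pt, (∀ n < k, y n = f xi n) → ∀ n, k ≤ n → frag i p' q' y n = y n := by
    intro y hy n hn
    obtain ⟨n, rfl⟩ : ∃ l, n = l + 1 := ⟨n - 1, by omega⟩
    rw [frag, twist_apply_succ, if_neg (hW y hy n (by omega))]
  refine ⟨h.germ.frag_comp_of_ne i p' q' (m := l) (by omega) hl, fun n hn => ?_, fun n hn => ?_,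
    fun n hn => ?_⟩
  · rw [hfix _ (fun _ _ => rfl) n hn]
    exact h.tile n hn
  · cases n with
    | zero => exact h.agree 0 hn
    | succ n =>
      rw [frag, twist_apply_succ, twist_apply_succ, h.agree _ hn]
      have : z ∈ W n ↔ f xi ∈ W n := by
        constructor
        · rintro ⟨h0, h2⟩
          exact ⟨by rw [← h.agree n (by omega)]; exact h0,
            fun l hl => by rw [← h.agree l (by omega)]; exact h2 l hl⟩
        · rintro ⟨h0, h2⟩
          exact ⟨by rw [h.agree n (by omega)]; exact h0,
            fun l hl => by rw [h.agree l (by omega)]; exact h2 l hl⟩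
      classical exact if_congr this rfl rfl
  · rw [hfix z h.agree n hn]
    exact h.rest n hn

/-- When the lifted walk is at `xi`, the walk in the bridge is in `W m`. The fragment then changes
the branch of the former and the letter `m + 1` of the latter, which names the copy. -/
theorem frag_step_of_eq (h : Follows i k K m z₀ f z p q) (hkm : k ≤ m)
    (hz₀ : z₀ ∈ bridge k m u) (hxi : f xi = xi) (p' q' : ZMod 3) :
    Follows i k K m z₀ (fun x => frag i p' q' (f x)) (frag i p' q' z) (p' + p) (q' + q) := by
  have hb := h.mem_bridge hkm hz₀
  have hz : z ∈ W m := by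
    refine ⟨hb.2.1, fun n hn => ?_⟩
    rcases lt_or_ge n k with hnk | hnk
    · rw [h.agree n hnk, hxi, xi]
    · exact hb.1 n hnk hn
  refine ⟨h.germ.frag_comp_of_eq hxi p' q', fun n _ => ?_, fun n hn => ?_, fun n hn => ?_⟩
  · rw [hxi, frag_xi, xi]
  · rw [frag_apply_of_mem_W hz, Function.update_of_ne (by omega), hxi, frag_xi, h.agree n hn, hxi]
  · rw [frag_apply_of_mem_W hz]
    by_cases hn' : n = m + 1
    · subst hn'
      rw [Function.update_self, Function.update_self, h.rest _ (by omega), Function.update_self,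
        coord_add]
      ring
    · rw [Function.update_of_ne hn', h.rest n hn, Function.update_of_ne hn',
        Function.update_of_ne hn']

theorem step (h : Follows i k K m z₀ f z p q) (hk : 1 ≤ k) (hK : k < K) (hkm : k ≤ m)
    (hz₀ : z₀ ∈ bridge k m u) {s : Equiv.Perm Pt} (hs : s ∈ Subgroup.zpowers a ∨ s ∈ H i)
    (heta : EndsInEta k (f xi) → s ∈ Subgroup.zpowers a) :
    ∃ p' q', Follows i k K m z₀ (fun x => s (f x)) (s z) p' q' := by
  -- The identity lies in both sets of letters. Testing for powers of `a` first leaves only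
  -- fragments, which `heta` excludes at the boundary point `0 2 ⋯ 2`.
  by_cases ha : s ∈ Subgroup.zpowers a
  · obtain ⟨e, rfl⟩ := exists_rot_of_mem_zpowers ha
    exact ⟨p, q, h.rot_step hk hK e⟩
  · obtain ⟨p', q', rfl⟩ := mem_H_iff.1 (hs.resolve_left ha)
    by_cases hxi : f xi = xi
    · exact ⟨_, _, h.frag_step_of_eq hkm hz₀ hxi p' q'⟩
    · exact ⟨_, _, h.frag_step_of_ne hk hK (fun h' => ha (heta h')) hxi p' q'⟩

end Follows

/-- At `0 2 ⋯ 2` a fragment preserves the last `k` letters. A walk beginning with one would touch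
this boundary point again at once, or end there without having crossed. -/
theorem IsTraverse.first_mem_zpowers {i : ZMod 4} {k : ℕ} (hk : 1 ≤ k) {B : Set Pt}
    {w : List (Equiv.Perm Pt)} {z : Pt} (h : IsTraverse k B w z) (hw : 0 < w.length)
    (hs : w[0] ∈ Subgroup.zpowers a ∨ w[0] ∈ H i) : w[0] ∈ Subgroup.zpowers a := by
  refine hs.resolve_right fun hH => ?_
  obtain ⟨p, q, hpq⟩ := mem_H_iff.1 hH
  have h1 : EndsInEta k (act (w.take 1) z) := by
    rw [List.take_succ_eq_append_getElem hw, List.take_zero, act_append_singleton, hpq, act_nil]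
    have hz := (endsInEta_iff hk).1 h.starts
    refine (EndsInEta.congr fun n hn => ?_).1 h.starts
    rw [frag_apply_of_mem_W hz, Function.update_of_ne (by omega)]
  have hlen : w.length = 1 := by
    by_contra hlen
    exact h.inside 1 one_pos (by omega) h1
  obtain ⟨j, hj, hx⟩ := h.crosses
  have hj01 : j = 0 ∨ j = 1 := by omega
  rcases hj01 with rfl | rfl
  · exact h.starts.not_endsInXi hk hx
  · exact h1.not_endsInXi hk hx

theorem IsTraverse.follows {i : ZMod 4} {k K m : ℕ} (hk : 1 ≤ k) (hK : k < K) (hkm : k ≤ m)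
    {w : List (Equiv.Perm Pt)} (hw : ∀ s ∈ w, s ∈ Subgroup.zpowers a ∨ s ∈ H i)
    {t : Equiv.Perm Pt} (hgerm : IsGerm K t (frag i 0 0))
    (htr : IsTraverse k (tile k) w (t xi)) {u z : Pt} (hz : z ∈ bridge k m u)
    (heta : EndsInEta k z) :
    ∀ j ≤ w.length, ∃ p q,
      Follows i k K m z (fun x => act (w.take j) (t x)) (act (w.take j) z) p q := by
  intro j
  induction j with
  | zero =>
    intro _
    refine ⟨0, 0, hgerm, htr.stays 0 (Nat.zero_le _), fun n hn => ?_, fun n _ => ?_⟩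
    · exact (heta n hn).trans (htr.starts n hn).symm
    · simp [coord]
  | succ j ih =>
    intro hj
    obtain ⟨p, q, h⟩ := ih (by omega)
    have hj' : j < w.length := by omega
    have hsj := hw _ (List.getElem_mem hj')
    obtain ⟨p', q', h'⟩ := h.step hk hK hkm hz hsj (fun he => by
      rcases Nat.eq_zero_or_pos j with rfl | hpos
      · exact htr.first_mem_zpowers hk hj' hsj
      · exact absurd he (htr.inside j hpos hj'))
    refine ⟨p', q', ?_⟩
    rw [List.take_succ_eq_append_getElem hj']
    simpa only [act_append_singleton] using h'

theorem IsTraverseOfType.passesConnector {i : ZMod 4} {k : ℕ} (hk : 1 ≤ k)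
    {w : List (Equiv.Perm Pt)} {p q : ZMod 3} (h : IsTraverseOfType i k w (frag i p q))
    (j : ZMod 4) : PassesConnector i k j w (coord p q j) := by
  obtain ⟨hw, t, ht, hbt, htr, hbw⟩ := h
  intro m hkm hj u z hz heta
  -- The radius `K` of the germ is enlarged beyond `k` to cover all letters that vary in the tile;
  -- uniqueness of the branch gives the exponents `0, 0`.
  obtain ⟨K, hkK, hgerm⟩ : ∃ K, k < K ∧ IsGerm K t (frag i 0 0) := by
    obtain ⟨K₀, p₀, q₀, h₀⟩ := exists_isGerm ht
    rw [← frag_zero i] at hbt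
    obtain ⟨rfl, rfl⟩ := h₀.inBranch.unique hbt
    exact ⟨max K₀ (k + 1), by omega, h₀.mono (le_max_left _ _)⟩
  have hF := htr.follows hk hkK hkm hw hgerm hz heta
  have hend : Follows i k K m z (fun x => act w (t x)) (act w z) p q := by
    obtain ⟨p', q', h'⟩ := hF w.length le_rfl
    rw [List.take_length] at h'
    obtain ⟨rfl, rfl⟩ := h'.germ.inBranch.unique hbw
    exact h'
  refine ⟨⟨fun j hj => ?_, heta, ?_, fun j hj0 hj => ?_, ?_⟩, ?_⟩
  · obtain ⟨_, _, h'⟩ := hF j hj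
    exact h'.mem_bridge hkm hz
  · exact (EndsInEta.congr hend.agree).2 htr.ends
  · obtain ⟨_, _, h'⟩ := hF j hj.le
    rw [EndsInEta.congr h'.agree]
    exact htr.inside j hj0 hj
  · obtain ⟨j, hj, hx⟩ := htr.crosses
    obtain ⟨_, _, h'⟩ := hF j hj
    exact ⟨j, hj, (EndsInXi.congr h'.agree).2 hx⟩
  · funext n
    rcases lt_or_ge n k with hn | hn
    · rw [hend.agree n hn, htr.ends n hn, Function.update_of_ne (by omega), heta n hn]
    · rw [hend.rest n hn, hj]

theorem PassesConnector.unique {i j : ZMod 4} {k : ℕ} {w : List (Equiv.Perm Pt)} {c c' : ZMod 3}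
    (h : PassesConnector i k j w c) (h' : PassesConnector i k j w c') : c = c' := by
  obtain ⟨m, hkm, hm⟩ := exists_index i j k
  -- A starting point of a bridge with tail `xi`; the letter `m + 1` of its image reads off the
  -- type.
  let z : Pt := fun n => if n + 1 = k ∨ n = m then 0 else 2
  have hz : z ∈ bridge k m xi := by
    refine ⟨fun n hn hnm => if_neg (by omega), if_pos (Or.inr rfl), fun n hn => if_neg (by omega)⟩
  have heta : EndsInEta k z := by
    intro n hn
    by_cases hnk : n + 1 = k
    · rw [if_pos hnk]; exact if_pos (Or.inl hnk)
    · rw [if_neg hnk]; exact if_neg (by omega)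
  have e := (h m hkm hm xi z hz heta).2
  rw [(h' m hkm hm xi z hz heta).2] at e
  have e1 := congrFun e (m + 1)
  rw [Function.update_self, Function.update_self] at e1
  exact (add_left_cancel e1).symm

theorem traverse_dichotomy {i : ZMod 4} {k : ℕ} (hk : 1 ≤ k) {h : Equiv.Perm Pt} (hh : h ∈ H i)
    (h1 : h ≠ 1) {w : List (Equiv.Perm Pt)} (hw : IsTraverseOfType i k w h) :
    (∀ j : ZMod 4, ∀ c : ZMod 3, ActsAs i j h c → PassesConnector i k j w c) ∧
      (∀ j : ZMod 4, ∀ c : ZMod 3, c ≠ 0 → PassesConnector i k j w c →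
        ∃ j' : ZMod 4, j' ≠ j ∧ PassesConnector i k j' w 0) := by
  obtain ⟨p, q, rfl⟩ := mem_H_iff.1 hh
  refine ⟨fun j c hc => ?_, fun j c hc hj => ?_⟩
  · rw [actsAs_frag_iff.1 hc]
    exact hw.passesConnector hk j
  · obtain ⟨j', hj', -⟩ := existsUnique_coord_eq_zero (fun h0 => h1 (frag_eq_one_iff.2 h0))
    have hP : PassesConnector i k j' w 0 := hj' ▸ hw.passesConnector hk j'
    refine ⟨j', ?_, hP⟩
    rintro rfl
    exact hc (hj.unique hP)

/-! ### Weighted lengths of alternating words -/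

/-- The weight of the letter `rot e`. -/
def rotWeight (e : ZMod 3) : ℕ := if e = 0 then 0 else 36

/-- The weight of the letter `frag i p q`. It grows with the number of levels after which
the first coordinate vanishes. -/
def fragWeight (i : ZMod 4) (p q : ZMod 3) : ℕ :=
  if p = 0 ∧ q = 0 then 0
  else if coord p q i = 0 then 36
  else if coord p q (i + 1) = 0 then 45
  else if coord p q (i + 2) = 0 then 54
  else 64

/-- Nonzero weights lie between `36` and `64`, and `64 ≤ 36 + 36`. -/
theorem fragWeight_add_le : ∀ (i : ZMod 4) (p q p' q' : ZMod 3),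
    fragWeight i (p + p') (q + q') ≤ fragWeight i p q + fragWeight i p' q' := by
  decide

/-- The term `36` on the right is the letter `rot` paired with the fragment. If the vanishing
coordinate is at `i, i + 1, i + 2, i + 3`, the sums compared are `64, 36 + 36, 36 + 45, 36 + 54` and
`72, 81, 90, 100`. In the first case the `rot` section is trivial, and this gain pays for the return
to the largest weight. -/
theorem fragWeight_contract : ∀ (i : ZMod 4) (p q : ZMod 3), ¬(p = 0 ∧ q = 0) →
    10 * (rotWeight (coord p q i) + fragWeight (i + 1) p q) ≤ 9 * (36 + fragWeight i p q) := by
  decide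

theorem fragWeight_pos : ∀ (i : ZMod 4) (p q : ZMod 3), ¬(p = 0 ∧ q = 0) →
    0 < fragWeight i p q := by
  decide

/-- `g` is the product of an alternating word of weight `n` in the letters `rot e` and
`frag i p q`; the flag says that the word is empty or starts with a letter `rot e` (if `true`),
or that it is empty or starts with a letter `frag i p q` (if `false`). -/
inductive Alt (i : ZMod 4) : Bool → ℕ → Equiv.Perm Pt → Prop
  | one (t : Bool) : Alt i t 0 1
  | rot {n : ℕ} {g : Equiv.Perm Pt} {e : ZMod 3} (h : Alt i false n g) (he : e ≠ 0) :
      Alt i true (n + 36) (rot e * g)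
  | frag {n : ℕ} {g : Equiv.Perm Pt} {p q : ZMod 3} (h : Alt i true n g)
      (hpq : ¬(p = 0 ∧ q = 0)) : Alt i false (n + fragWeight i p q) (frag i p q * g)

/-- `g` is the product of an alternating word of weight at most `n`. -/
def Ball (i : ZMod 4) (n : ℕ) (g : Equiv.Perm Pt) : Prop := ∃ t, ∃ m ≤ n, Alt i t m g

theorem Ball.mono {i : ZMod 4} {m n : ℕ} {g : Equiv.Perm Pt} (h : Ball i m g) (hmn : m ≤ n) :
    Ball i n g := by
  obtain ⟨t, l, hl, h⟩ := h
  exact ⟨t, l, hl.trans hmn, h⟩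

theorem Ball.one (i : ZMod 4) (n : ℕ) : Ball i n 1 := ⟨true, 0, Nat.zero_le _, .one _⟩

theorem Alt.rot_mul {i : ZMod 4} {t : Bool} {n : ℕ} {g : Equiv.Perm Pt} (h : Alt i t n g)
    (e : ZMod 3) : Ball i (n + rotWeight e) (FabrykowskiGupta.rot e * g) := by
  by_cases he : e = 0
  · subst he
    exact ⟨t, n, by simp [rotWeight], by simpa using h⟩
  rw [rotWeight, if_neg he]
  cases h with
  | one t => exact ⟨true, 0 + 36, le_rfl, (Alt.one false).rot he⟩
  | @rot m g' f h hf =>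
    rw [← mul_assoc, FabrykowskiGupta.rot_mul]
    by_cases hef : e + f = 0
    · rw [hef, rot_zero, one_mul]
      exact ⟨false, m, by omega, h⟩
    · exact ⟨true, m + 36, by omega, h.rot hef⟩
  | frag h hpq => exact ⟨true, _, le_rfl, (h.frag hpq).rot he⟩

theorem Alt.frag_mul {i : ZMod 4} {t : Bool} {n : ℕ} {g : Equiv.Perm Pt} (h : Alt i t n g)
    (p q : ZMod 3) : Ball i (n + fragWeight i p q) (FabrykowskiGupta.frag i p q * g) := by
  by_cases hpq : p = 0 ∧ q = 0
  · obtain ⟨rfl, rfl⟩ := hpq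
    exact ⟨t, n, by simp [fragWeight], by simpa using h⟩
  cases h with
  | one t => exact ⟨false, _, le_rfl, (Alt.one true).frag hpq⟩
  | rot h he => exact ⟨false, _, le_rfl, (h.rot he).frag hpq⟩
  | @frag m g' p' q' h hpq' =>
    rw [← mul_assoc, FabrykowskiGupta.frag_mul]
    have hw := fragWeight_add_le i p q p' q'
    by_cases h0 : p + p' = 0 ∧ q + q' = 0
    · rw [h0.1, h0.2, frag_zero, one_mul]
      exact ⟨true, m, by omega, h⟩
    · exact ⟨false, m + fragWeight i (p + p') (q + q'), by omega, h.frag h0⟩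

theorem Ball.rot_mul {i : ZMod 4} {n : ℕ} {g : Equiv.Perm Pt} (h : Ball i n g) (e : ZMod 3) :
    Ball i (n + rotWeight e) (rot e * g) := by
  obtain ⟨t, m, hm, h⟩ := h
  exact (h.rot_mul e).mono (by omega)

theorem Ball.frag_mul {i : ZMod 4} {n : ℕ} {g : Equiv.Perm Pt} (h : Ball i n g) (p q : ZMod 3) :
    Ball i (n + fragWeight i p q) (frag i p q * g) := by
  obtain ⟨t, m, hm, h⟩ := h
  exact (h.frag_mul p q).mono (by omega)

theorem Ball.mul {i : ZMod 4} {m n : ℕ} {g h : Equiv.Perm Pt} (hg : Ball i m g)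
    (hh : Ball i n h) : Ball i (m + n) (g * h) := by
  obtain ⟨t, l, hl, hg⟩ := hg
  suffices Ball i (l + n) (g * h) from this.mono (by omega)
  clear hl
  induction hg with
  | one t => simpa using hh
  | @rot l g e _ he ih =>
    rw [mul_assoc]
    refine (ih.rot_mul e).mono ?_
    rw [rotWeight, if_neg he]
    omega
  | @frag l g p q _ _ ih =>
    rw [mul_assoc]
    exact (ih.frag_mul p q).mono (by omega)

theorem exists_ball {i : ZMod 4} {g : Equiv.Perm Pt} (hg : g ∈ G i) : ∃ n, Ball i n g :=
  G_induction (motive := fun g => ∃ n, Ball i n g) ⟨0, .one i 0⟩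
    (fun e _ _ ⟨_, h⟩ => ⟨_, h.rot_mul e⟩) (fun p q _ _ ⟨_, h⟩ => ⟨_, h.frag_mul p q⟩) hg

/-! ### Contraction -/

theorem sum_letters {M : Type*} [AddCommMonoid M] (f : ZMod 3 → M) :
    ∑ y, f y = f 0 + f 1 + f 2 := Fin.sum_univ_three f

/-- The sections of `frag i p q`. -/
def fragSection (i : ZMod 4) (p q : ZMod 3) : ZMod 3 → Equiv.Perm Pt :=
  ![rot (coord p q i), 1, frag (i + 1) p q]

/-- The weights of the sections of `frag i p q`. -/
def sectionWeight (i : ZMod 4) (p q : ZMod 3) : ZMod 3 → ℕ :=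
  ![rotWeight (coord p q i), 0, fragWeight (i + 1) p q]

theorem frag_snoc (i : ZMod 4) (p q : ZMod 3) (v : Pt) (y : ZMod 3) :
    frag i p q (snoc v y) = snoc (fragSection i p q y v) y := by
  rcases letter_cases y with rfl | rfl | rfl
  · exact frag_snoc_zero i p q v
  · exact frag_snoc_one i p q v
  · exact frag_snoc_two i p q v

theorem Ball.fragSection_mul {i : ZMod 4} {n : ℕ} {g : Equiv.Perm Pt} (h : Ball (i + 1) n g)
    (p q y : ZMod 3) :
    Ball (i + 1) (n + sectionWeight i p q y) (fragSection i p q y * g) := by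
  rcases letter_cases y with rfl | rfl | rfl
  · exact h.rot_mul _
  · exact h
  · exact h.frag_mul p q

/-- In an alternating word each fragment is followed by its own letter `rot`, except possibly the
last one. This exception costs the extra `36` when the word starts with a fragment. Letters `rot`
only permute the sections. -/
theorem Alt.exists_sections {i : ZMod 4} {t : Bool} {n : ℕ} {g : Equiv.Perm Pt}
    (h : Alt i t n g) :
    ∃ (σ : Equiv.Perm (ZMod 3)) (s : ZMod 3 → Equiv.Perm Pt) (r : ZMod 3 → ℕ),
      (∀ y v, g (snoc v y) = snoc (s y v) (σ y)) ∧ (∀ y, Ball (i + 1) (r y) (s y)) ∧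
      10 * ∑ y, r y ≤ 9 * (n + bif t then 0 else 36) := by
  induction h with
  | one t =>
    exact ⟨1, fun _ => 1, fun _ => 0, fun _ _ => rfl, fun _ => .one _ _, by simp⟩
  | @rot n g e _ _ ih =>
    obtain ⟨σ, s, r, h1, h2, h3⟩ := ih
    refine ⟨σ.trans (Equiv.addRight e), s, r, fun y v => ?_, h2, by simpa using h3⟩
    rw [Equiv.Perm.mul_apply, h1, rot_snoc]
    rfl
  | @frag n g p q _ hpq ih =>
    obtain ⟨σ, s, r, h1, h2, h3⟩ := ih
    refine ⟨σ, fun y => fragSection i p q (σ y) * s y,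
      fun y => r y + sectionWeight i p q (σ y), fun y v => ?_,
      fun y => (h2 y).fragSection_mul p q _, ?_⟩
    · rw [Equiv.Perm.mul_apply, h1, frag_snoc]
      rfl
    · have h4 := fragWeight_contract i p q hpq
      have h5 : ∑ y, sectionWeight i p q y =
          rotWeight (coord p q i) + 0 + fragWeight (i + 1) p q := sum_letters _
      rw [Finset.sum_add_distrib, Equiv.sum_comp σ (sectionWeight i p q), h5]
      simp only [cond_true, cond_false] at h3 ⊢
      omega

theorem Ball.exists_sections {i : ZMod 4} {n : ℕ} {g : Equiv.Perm Pt} (h : Ball i n g) :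
    ∃ (σ : Equiv.Perm (ZMod 3)) (s : ZMod 3 → Equiv.Perm Pt) (r : ZMod 3 → ℕ),
      (∀ y v, g (snoc v y) = snoc (s y v) (σ y)) ∧ (∀ y, Ball (i + 1) (r y) (s y)) ∧
      10 * ∑ y, r y ≤ 9 * (n + 36) := by
  obtain ⟨t, m, hm, h⟩ := h
  obtain ⟨σ, s, r, h1, h2, h3⟩ := h.exists_sections
  refine ⟨σ, s, r, h1, h2, h3.trans ?_⟩
  cases t <;> simp only [cond_true, cond_false] <;> omega

/-! ### Counting -/

theorem Alt.eq_one_or {i : ZMod 4} {t : Bool} {n : ℕ} {g : Equiv.Perm Pt} (h : Alt i t n g) :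
    g = 1 ∨ ∃ l ∈ Set.range FabrykowskiGupta.rot ∪
      Set.range (fun z : ZMod 3 × ZMod 3 => FabrykowskiGupta.frag i z.1 z.2),
      ∃ g', ∃ m < n, Ball i m g' ∧ l * g' = g := by
  cases h with
  | one => exact Or.inl rfl
  | @rot m g' e h _ =>
    exact Or.inr ⟨_, Or.inl ⟨e, rfl⟩, g', m, by omega, ⟨_, m, le_rfl, h⟩, rfl⟩
  | @frag m g' p q h hpq =>
    have := fragWeight_pos i p q hpq
    exact Or.inr ⟨_, Or.inr ⟨(p, q), rfl⟩, g', m, by omega, ⟨_, m, le_rfl, h⟩, rfl⟩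

/-- All letters of an alternating word have positive weight, so removing the first one lowers the
weight. -/
theorem finite_ball (i : ZMod 4) (n : ℕ) : {g | Ball i n g}.Finite := by
  induction n with
  | zero =>
    refine (Set.finite_singleton 1).subset ?_
    rintro g ⟨t, m, hm, h⟩
    rcases h.eq_one_or with rfl | ⟨_, _, _, l, hl, _⟩
    · rfl
    · omega
  | succ n ih =>
    refine ((Set.finite_singleton 1).union (Set.Finite.image2 (· * ·)
      ((Set.finite_range rot).union
        (Set.finite_range fun z : ZMod 3 × ZMod 3 => frag i z.1 z.2)) ih)).subset ?_
    rintro g ⟨t, m, hm, h⟩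
    rcases h.eq_one_or with rfl | ⟨l, hl, g', k, hk, hg', rfl⟩
    · exact Or.inl rfl
    · exact Or.inr ⟨l, hl, g', hg'.mono (by omega), rfl⟩

/-- The elements that are products of alternating words of weight at most `n`, as a finite set. -/
noncomputable def ballFinset (i : ZMod 4) (n : ℕ) : Finset (Equiv.Perm Pt) :=
  (finite_ball i n).toFinset

theorem mem_ballFinset {i : ZMod 4} {n : ℕ} {g : Equiv.Perm Pt} :
    g ∈ ballFinset i n ↔ Ball i n g := by
  simp [ballFinset]

/-- An element is determined by its permutation of the last letter and its three sections. There are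
`6` permutations and at most `(n + 40) ^ 3` weight triples, as each `r y ≤ 9/10 * (n + 36) < n +
40`; each triple allows at most `B` choices of sections. -/
theorem card_ballFinset_le {i : ZMod 4} {n B : ℕ}
    (hB : ∀ r : ZMod 3 → ℕ, 10 * ∑ y, r y ≤ 9 * (n + 36) →
      ∏ y, (ballFinset (i + 1) (r y)).card ≤ B) :
    (ballFinset i n).card ≤ 6 * (n + 40) ^ 3 * B := by
  let I : Finset (Equiv.Perm (ZMod 3) × (ZMod 3 → ℕ)) :=
    {x ∈ Finset.univ ×ˢ Fintype.piFinset (fun _ => Finset.range (n + 40)) |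
      10 * ∑ y, x.2 y ≤ 9 * (n + 36)}
  have hsec : ∀ g, Ball i n g →
      ∃ x : (_ : Equiv.Perm (ZMod 3) × (ZMod 3 → ℕ)) × (ZMod 3 → Equiv.Perm Pt),
        (∀ y v, g (snoc v y) = snoc (x.2 y v) (x.1.1 y)) ∧
        (∀ y, Ball (i + 1) (x.1.2 y) (x.2 y)) ∧ 10 * ∑ y, x.1.2 y ≤ 9 * (n + 36) := by
    intro g hg
    obtain ⟨σ, s, r, h⟩ := hg.exists_sections
    exact ⟨⟨(σ, r), s⟩, h⟩
  have : Nonempty ((_ : Equiv.Perm (ZMod 3) × (ZMod 3 → ℕ)) × (ZMod 3 → Equiv.Perm Pt)) :=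
    ⟨⟨(1, 0), 1⟩⟩
  choose! F hF using hsec
  have hcard : (ballFinset i n).card ≤
      (I.sigma fun x => Fintype.piFinset fun y => ballFinset (i + 1) (x.2 y)).card := by
    refine Finset.card_le_card_of_injOn F ?_ ?_
    · intro g hg
      obtain ⟨-, h2, h3⟩ := hF g (mem_ballFinset.1 hg)
      simp only [Finset.coe_sigma, Set.mem_sigma_iff, Finset.mem_coe, I, Finset.mem_filter,
        Finset.mem_product, Finset.mem_univ, true_and, Fintype.mem_piFinset, Finset.mem_range,
        mem_ballFinset]
      refine ⟨⟨fun y => ?_, h3⟩, h2⟩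
      have := Finset.single_le_sum (f := (F g).1.2) (fun _ _ => Nat.zero_le _)
        (Finset.mem_univ y)
      omega
    · intro g hg g' hg' hgg'
      obtain ⟨h, -⟩ := hF g (mem_ballFinset.1 hg)
      obtain ⟨h', -⟩ := hF g' (mem_ballFinset.1 hg')
      ext x : 1
      rw [← snoc_tail x, h, h', hgg']
  have hI : I.card ≤ 6 * (n + 40) ^ 3 := by
    refine (Finset.card_filter_le _ _).trans_eq ?_
    rw [Finset.card_product, Finset.card_univ, Fintype.card_perm, Fintype.card_piFinset,
      Finset.prod_const, Finset.card_range, Finset.card_univ, ZMod.card]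
    rfl
  rw [Finset.card_sigma] at hcard
  refine hcard.trans (le_trans (Finset.sum_le_card_nsmul I _ B ?_) ?_)
  · intro x hx
    rw [Fintype.card_piFinset]
    exact hB x.2 (Finset.mem_filter.1 hx).2
  · rw [smul_eq_mul]
    exact Nat.mul_le_mul_right B hI

/-! ### The growth estimate -/

/-- Jensen's inequality for the concave function `x ^ β` with equal weights `1/3`. -/
theorem sum_rpow_le {β : ℝ} (h0 : 0 ≤ β) (h1 : β ≤ 1) (f : ZMod 3 → ℝ) (hf : ∀ y, 0 ≤ f y) :
    ∑ y, f y ^ β ≤ 3 ^ (1 - β) * (∑ y, f y) ^ β := by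
  have h := (Real.concaveOn_rpow h0 h1).le_map_sum (t := Finset.univ)
    (w := fun _ : ZMod 3 => (1 / 3 : ℝ)) (p := f) (fun _ _ => by norm_num)
    (by simp [ZMod.card]) (fun y _ => hf y)
  simp only [smul_eq_mul, ← Finset.mul_sum] at h
  rw [Real.mul_rpow (by norm_num) (Finset.sum_nonneg fun y _ => hf y),
    Real.div_rpow (by norm_num) (by norm_num), Real.one_rpow] at h
  rw [Real.rpow_sub (by norm_num), Real.rpow_one]
  calc ∑ y, f y ^ β = 3 * (1 / 3 * ∑ y, f y ^ β) := by ring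
    _ ≤ 3 * (1 / 3 ^ β * (∑ y, f y) ^ β) := by gcongr
    _ = _ := by ring

/-- The gap `1 - θ` is halved: one half absorbs the logarithms, the other the shift from `n + 40` to
`n + 1`. -/
theorem eventually_log_add_rpow_le {β θ : ℝ} (hβ0 : 0 < β) (hβ1 : β ≤ 1) (hθ0 : 0 ≤ θ)
    (hθ1 : θ < 1) :
    ∀ᶠ n : ℕ in atTop, Real.log 6 + 3 * Real.log (n + 40) + θ * ((n : ℝ) + 40) ^ β ≤
      ((n : ℝ) + 1) ^ β := by
  have hε : 0 < (1 - θ) / 2 := by linarith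
  have hx : Tendsto (fun n : ℕ => (n : ℝ) + 40) atTop atTop :=
    tendsto_atTop_add_const_right _ _ tendsto_natCast_atTop_atTop
  have hlog : ∀ᶠ x : ℝ in atTop, Real.log 6 + 3 * Real.log x ≤ (1 - θ) / 2 * x ^ β := by
    have h1 := (isLittleO_log_rpow_atTop hβ0).bound (c := (1 - θ) / 2 / 4) (by positivity)
    filter_upwards [h1, eventually_ge_atTop 6] with x hx h6
    rw [Real.norm_of_nonneg (Real.log_nonneg (by linarith)),
      Real.norm_of_nonneg (Real.rpow_nonneg (by linarith) _)] at hx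
    have := Real.log_le_log (by norm_num) h6
    linarith
  have hlin : ∀ᶠ x : ℝ in atTop, (1 + θ) / 2 * x ≤ x - 39 := by
    filter_upwards [eventually_ge_atTop (39 / ((1 - θ) / 2))] with x hx
    rw [div_le_iff₀ hε] at hx
    linarith
  filter_upwards [hx.eventually hlog, hx.eventually hlin] with n h1 h2
  have hn : (0 : ℝ) ≤ (n : ℝ) + 40 := by positivity
  have h3 : (1 + θ) / 2 * ((n : ℝ) + 40) ^ β ≤ ((n : ℝ) + 1) ^ β := by
    calc (1 + θ) / 2 * ((n : ℝ) + 40) ^ β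
        = ((1 + θ) / 2) ^ (1 : ℝ) * ((n : ℝ) + 40) ^ β := by rw [Real.rpow_one]
      _ ≤ ((1 + θ) / 2) ^ β * ((n : ℝ) + 40) ^ β := by
          gcongr ?_ * _
          exact Real.rpow_le_rpow_of_exponent_ge (by linarith) (by linarith) hβ1
      _ = ((1 + θ) / 2 * ((n : ℝ) + 40)) ^ β := by
          rw [Real.mul_rpow (by linarith) hn]
      _ ≤ ((n : ℝ) + 1) ^ β := by
          apply Real.rpow_le_rpow (mul_nonneg (by linarith) hn) (by linarith) hβ0.le
  linarith

/-- The twelfth power of the left side is `3 * (9/10) ^ 11 < 1`. -/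
theorem three_rpow_mul_rpow_lt_one :
    (3 : ℝ) ^ (1 - 11 / 12 : ℝ) * (9 / 10 : ℝ) ^ (11 / 12 : ℝ) < 1 := by
  have h : (3 : ℝ) ^ (1 - 11 / 12 : ℝ) * (9 / 10 : ℝ) ^ (11 / 12 : ℝ) =
      (3 * (9 / 10 : ℝ) ^ 11) ^ (1 / 12 : ℝ) := by
    rw [Real.mul_rpow (by norm_num) (by norm_num), ← Real.rpow_natCast,
      ← Real.rpow_mul (by norm_num)]
    norm_num
  rw [h]
  exact Real.rpow_lt_one (by norm_num) (by norm_num) (by norm_num)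

theorem exists_card_ballFinset_le_exp :
    ∃ C : ℝ, 1 ≤ C ∧ ∀ n i, ((ballFinset i n).card : ℝ) ≤
      Real.exp (C * ((n : ℝ) + 1) ^ (11 / 12 : ℝ)) := by
  set β : ℝ := 11 / 12 with hβ
  set θ : ℝ := 3 ^ (1 - β) * (9 / 10 : ℝ) ^ β with hθ
  have hθ0 : 0 ≤ θ := by positivity
  obtain ⟨N, hN⟩ := eventually_atTop.1 (eventually_log_add_rpow_le (β := β) (θ := θ)
    (by norm_num [hβ]) (by norm_num [hβ]) hθ0 three_rpow_mul_rpow_lt_one)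
  -- From `n = 325` on, `9/10 * (n + 36) < n`, so all sections have smaller weight and the induction
  -- hypothesis applies to them.
  obtain ⟨C₀, hC₀⟩ : ∃ C₀ : ℝ, ∀ n < max N 325, ∀ i, ((ballFinset i n).card : ℝ) ≤ C₀ := by
    obtain ⟨C₀, h⟩ := ((Finset.range (max N 325) ×ˢ (Finset.univ : Finset (ZMod 4))).image
      fun x => ((ballFinset x.2 x.1).card : ℝ)).bddAbove
    exact ⟨C₀, fun n hn i => h (Finset.mem_image.2 ⟨(n, i), by simp [hn], rfl⟩)⟩
  refine ⟨max 1 C₀, le_max_left _ _, ?_⟩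
  set C := max 1 C₀
  have hC1 : 1 ≤ C := le_max_left _ _
  intro n
  induction n using Nat.strong_induction_on with
  | _ n ih =>
  intro i
  rcases lt_or_ge n (max N 325) with hn | hn
  · have h1 : (1 : ℝ) ≤ ((n : ℝ) + 1) ^ β :=
      Real.one_le_rpow (by linarith [Nat.cast_nonneg (α := ℝ) n]) (by norm_num [hβ])
    calc ((ballFinset i n).card : ℝ) ≤ C := (hC₀ n hn i).trans (le_max_right _ _)
      _ ≤ C * ((n : ℝ) + 1) ^ β := le_mul_of_one_le_right (by linarith) h1
      _ ≤ C * ((n : ℝ) + 1) ^ β + 1 := by linarith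
      _ ≤ _ := Real.add_one_le_exp _
  have hNn := hN n (le_trans (le_max_left _ _) hn)
  have hn325 : 325 ≤ n := le_trans (le_max_right _ _) hn
  have hprod : ∀ r : ZMod 3 → ℕ, 10 * ∑ y, r y ≤ 9 * (n + 36) →
      ∏ y, (ballFinset (i + 1) (r y)).card ≤
        ⌊Real.exp (C * (θ * ((n : ℝ) + 40) ^ β))⌋₊ := by
    intro r hr
    have hlt : ∀ y, r y < n := by
      intro y
      have := Finset.single_le_sum (f := r) (fun _ _ => Nat.zero_le _) (Finset.mem_univ y)
      omega
    have hr' : (10 : ℝ) * ∑ y, (r y : ℝ) ≤ 9 * (n + 36) := by exact_mod_cast hr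
    have hsum : ∑ y, ((r y : ℝ) + 1) = ∑ y, (r y : ℝ) + 3 := by
      rw [Finset.sum_add_distrib]
      simp [ZMod.card]
    apply Nat.le_floor
    push_cast
    calc ∏ y, ((ballFinset (i + 1) (r y)).card : ℝ)
        ≤ ∏ y, Real.exp (C * ((r y : ℝ) + 1) ^ β) :=
          Finset.prod_le_prod (fun _ _ => Nat.cast_nonneg _) (fun y _ => ih _ (hlt y) _)
      _ = Real.exp (C * ∑ y, ((r y : ℝ) + 1) ^ β) := by
          rw [← Real.exp_sum, Finset.mul_sum]
      _ ≤ Real.exp (C * (3 ^ (1 - β) * (∑ y, ((r y : ℝ) + 1)) ^ β)) := by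
          gcongr
          exact sum_rpow_le (by norm_num [hβ]) (by norm_num [hβ]) _ fun y => by positivity
      -- The three shifts by `1` add `3`, and `9/10 * (n + 36) + 3 ≤ 9/10 * (n + 40)`.
      _ ≤ Real.exp (C * (3 ^ (1 - β) * (9 / 10 * ((n : ℝ) + 40)) ^ β)) := by
          gcongr
          rw [hsum]
          linarith
      _ = _ := by
          rw [Real.mul_rpow (by norm_num) (by positivity), hθ]
          ring_nf
  have hcard := card_ballFinset_le hprod
  have h40 : (0 : ℝ) < (n : ℝ) + 40 := by positivity
  calc ((ballFinset i n).card : ℝ)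
      ≤ 6 * ((n : ℝ) + 40) ^ 3 * (⌊Real.exp (C * (θ * ((n : ℝ) + 40) ^ β))⌋₊ : ℝ) := by
        exact_mod_cast hcard
    _ ≤ 6 * ((n : ℝ) + 40) ^ 3 * Real.exp (C * (θ * ((n : ℝ) + 40) ^ β)) := by
        gcongr
        exact Nat.floor_le (Real.exp_pos _).le
    _ = Real.exp (Real.log 6 + 3 * Real.log (n + 40) + C * (θ * ((n : ℝ) + 40) ^ β)) := by
        have hexp : Real.exp (3 * Real.log ((n : ℝ) + 40)) = ((n : ℝ) + 40) ^ 3 := by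
          rw [← Nat.cast_ofNat, Real.exp_nat_mul, Real.exp_log h40]
        rw [Real.exp_add, Real.exp_add, Real.exp_log (by norm_num), hexp]
    _ ≤ Real.exp (C * ((n : ℝ) + 1) ^ β) := by
        rw [Real.exp_le_exp]
        have hlog : 0 ≤ Real.log 6 + 3 * Real.log ((n : ℝ) + 40) := by
          have h6 := Real.log_nonneg (x := 6) (by norm_num)
          have h40' := Real.log_nonneg (x := (n : ℝ) + 40)
            (by linarith [Nat.cast_nonneg (α := ℝ) n])
          linarith
        -- As `C ≥ 1`, the inequality `hNn` for constant `1` implies the one for `C`, whose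
        -- logarithmic terms are not multiplied by `C`.
        nlinarith [mul_nonneg (sub_nonneg.2 hC1) (hlog.trans (le_sub_iff_add_le.2 hNn))]

theorem dominated_growth {i : ZMod 4} {S : Set (G i)} (hS : S.Finite) {α : ℝ}
    (hα : 11 / 12 ≤ α) :
    Dominated (fun R => (growth S R : ℝ)) (fun R => Real.exp (R ^ α)) := by
  obtain ⟨C, hC1, hC⟩ := exists_card_ballFinset_le_exp
  obtain ⟨L, hL⟩ : ∃ L, ∀ s ∈ S, Ball i L (s : Equiv.Perm Pt) := by
    choose ℓ hℓ using fun s : G i => exists_ball s.2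
    obtain ⟨L, hL⟩ := (hS.image ℓ).bddAbove
    exact ⟨L, fun s hs => (hℓ s).mono (hL (Set.mem_image_of_mem _ hs))⟩
  have hprod : ∀ l : List (G i), (∀ s ∈ l, s ∈ S) →
      Ball i (L * l.length) (l.prod : Equiv.Perm Pt) := by
    intro l
    induction l with
    | nil => exact fun _ => .one i _
    | cons s l ih =>
      intro h
      rw [List.prod_cons, Subgroup.coe_mul]
      refine ((hL s (h s (by simp))).mul (ih fun t ht => h t (by simp [ht]))).mono ?_
      rw [List.length_cons, mul_add, mul_one, add_comm]
  have hgrowth : ∀ R : ℝ, 0 ≤ R → growth S R ≤ (ballFinset i (L * ⌊R⌋₊)).card := by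
    intro R hR
    rw [growth, ← Set.ncard_coe_finset]
    refine Set.ncard_le_ncard_of_injOn (fun g : G i => (g : Equiv.Perm Pt)) ?_
      (fun _ _ _ _ h => Subtype.ext h) (Finset.finite_toSet _)
    rintro _ ⟨l, hl, rfl, hlR⟩
    exact mem_ballFinset.2 ((hprod l hl).mono (Nat.mul_le_mul_left L (Nat.le_floor hlR)))
  have hL0 : (0 : ℝ) ≤ L := Nat.cast_nonneg L
  have hC2 : 1 ≤ C ^ 2 := one_le_pow₀ hC1
  -- The square lets `C` move inside the power: `(C ^ 2) ^ (11/12) ≥ C`.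
  refine ⟨C ^ 2 * (L + 1), by nlinarith, fun R hR => ?_⟩
  have hfloor : (⌊R⌋₊ : ℝ) ≤ R := Nat.floor_le (by linarith)
  have hLR : (1 : ℝ) ≤ (L + 1) * R := by nlinarith
  calc (growth S R : ℝ) ≤ ((ballFinset i (L * ⌊R⌋₊)).card : ℝ) := by
        exact_mod_cast hgrowth R (by linarith)
    _ ≤ Real.exp (C * (((L * ⌊R⌋₊ : ℕ) : ℝ) + 1) ^ (11 / 12 : ℝ)) := hC _ _
    _ ≤ Real.exp ((C ^ 2) ^ (11 / 12 : ℝ) * ((L + 1) * R) ^ (11 / 12 : ℝ)) := by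
        gcongr
        · rw [← Real.rpow_natCast, ← Real.rpow_mul (by linarith)]
          calc C = C ^ (1 : ℝ) := (Real.rpow_one C).symm
            _ ≤ _ := Real.rpow_le_rpow_of_exponent_le hC1 (by norm_num)
        · push_cast
          nlinarith
    _ = Real.exp ((C ^ 2 * (L + 1) * R) ^ (11 / 12 : ℝ)) := by
        rw [← Real.mul_rpow (by positivity) (by linarith), mul_assoc]
    _ ≤ Real.exp ((C ^ 2 * (L + 1) * R) ^ α) := by
        gcongr
        rw [mul_assoc]
        nlinarith

/-! ### The exponent -/

theorem exponent_bounds {η : ℝ} (hη : η = (3 / 4 : ℝ) ^ (1 / 3 : ℝ)) :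
    |Real.log 3 / (Real.log 3 - Real.log η) - 0.9197| < 0.00005 := by
  have h2 : 0 < Real.log 2 := Real.log_pos (by norm_num)
  have h3 : 0 < Real.log 3 := Real.log_pos (by norm_num)
  have hlog : Real.log η = (Real.log 3 - 2 * Real.log 2) / 3 := by
    rw [hη, Real.log_rpow (by norm_num), Real.log_div (by norm_num) (by norm_num),
      show (4 : ℝ) = 2 ^ 2 by norm_num, Real.log_pow]
    push_cast
    ring
  -- The exponent equals `3 log 3 / (2 log 3 + 2 log 2)`, so bounds on `log 3 / log 2` suffice: it
  -- lies between `84/53` and `233/147`.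
  have hlower : 84 * Real.log 2 < 53 * Real.log 3 := by
    have := Real.log_lt_log (by norm_num) (show (2 : ℝ) ^ 84 < 3 ^ 53 by norm_num)
    simpa only [Real.log_pow, Nat.cast_ofNat] using this
  have hupper : 147 * Real.log 3 < 233 * Real.log 2 := by
    have := Real.log_lt_log (by norm_num) (show (3 : ℝ) ^ 147 < 2 ^ 233 by norm_num)
    simpa only [Real.log_pow, Nat.cast_ofNat] using this
  have hpos : 0 < Real.log 3 - Real.log η := by rw [hlog]; linarith
  rw [abs_sub_lt_iff, sub_lt_iff_lt_add, div_lt_iff₀ hpos, sub_lt_comm, lt_div_iff₀ hpos, hlog]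
  constructor <;> linarith

end FabrykowskiGupta

open FabrykowskiGupta in
theorem mainTheorem7 :
    -- the wreath recursions of `a` and `b` and of the fragments, and the self-similar family
    ((∀ v : Pt, ∀ y : ZMod 3, a (snoc v y) = snoc v (y + 1)) ∧
      (∀ v : Pt, b (snoc v 0) = snoc (a v) 0 ∧ b (snoc v 1) = snoc v 1 ∧
        b (snoc v 2) = snoc (b v) 2) ∧
      (∀ i : ZMod 4, ∀ v : Pt,
        b₁ i (snoc v 0) = snoc ((a ^ (e₁ i).val) v) 0 ∧ b₁ i (snoc v 1) = snoc v 1 ∧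
        b₁ i (snoc v 2) = snoc (b₁ (i + 1) v) 2 ∧
        b₂ i (snoc v 0) = snoc ((a ^ (e₂ i).val) v) 0 ∧ b₂ i (snoc v 1) = snoc v 1 ∧
        b₂ i (snoc v 2) = snoc (b₂ (i + 1) v) 2) ∧
      (∀ i : ZMod 4, ∀ g ∈ G i, ∀ y : ZMod 3, ∃ y' : ZMod 3, ∃ g' ∈ G (i + 1),
        ∀ v : Pt, g (snoc v y) = snoc (g' v) y')) ∧
    -- `H_i` is a fragmentation of `b`, isomorphic to `(ℤ/3)²`, every non-identity element of it
    -- has exactly one vanishing coordinate, and it is the group of germs of `G_i` at `xi`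
    (∀ i : ZMod 4,
      Nonempty (H i ≃* Multiplicative (ZMod 3 × ZMod 3)) ∧
      (∀ j : ZMod 4, ActsAs i j (b₁ i) (e₁ j) ∧ ActsAs i j (b₂ i) (e₂ j)) ∧
      (∀ h ∈ H i, (∀ x : Pt, b x = x → h x = x) ∧ ∀ j : ZMod 4, ∃! c : ZMod 3, ActsAs i j h c) ∧
      (∀ h ∈ H i, h ≠ 1 → ∃! j : ZMod 4, ActsAs i j h 0) ∧
      (∀ h ∈ H i, h xi = xi) ∧
      (∀ g ∈ G i, g xi = xi → ∃! h : Equiv.Perm Pt, h ∈ H i ∧ ∀ᶠ x in 𝓝 xi, g x = h x) ∧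
      (∀ g ∈ G i, ∃! h : Equiv.Perm Pt, h ∈ H i ∧ InBranch g h)) ∧
    -- a traverse of nontrivial type passes through the connectors according to its type, and
    -- if it is of nontrivial type through one of them, it is of type `Id` through another one
    (∀ i : ZMod 4, ∀ k : ℕ, 2 ≤ k → ∀ h ∈ H i, h ≠ 1 →
      ∀ w : List (Equiv.Perm Pt), IsTraverseOfType i k w h →
        (∀ j : ZMod 4, ∀ c : ZMod 3, ActsAs i j h c → PassesConnector i k j w c) ∧
        (∀ j : ZMod 4, ∀ c : ZMod 3, c ≠ 0 → PassesConnector i k j w c →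
          ∃ j' : ZMod 4, j' ≠ j ∧ PassesConnector i k j' w 0)) ∧
    -- the growth estimate
    (∀ η : ℝ, η = (3 / 4 : ℝ) ^ (1 / 3 : ℝ) →
      |Real.log 3 / (Real.log 3 - Real.log η) - 0.9197| < 0.00005 ∧
      ∀ i : ZMod 4, ∀ S : Set (G i), S.Finite → (∀ s ∈ S, s⁻¹ ∈ S) → Subgroup.closure S = ⊤ →
        ∀ α : ℝ, Real.log 3 / (Real.log 3 - Real.log η) < α →
          Dominated (fun R => (growth S R : ℝ)) (fun R => Real.exp (R ^ α))) := by
  refine ⟨⟨a_snoc, fun v => ?_, fun i v => ?_, fun i g hg y => exists_section hg y⟩, fun i => ?_,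
    fun i k hk h hh h1 w hw => traverse_dichotomy (by omega) hh h1 hw,
    fun η hη => ⟨exponent_bounds hη, fun i S hS _ _ α hα => dominated_growth hS ?_⟩⟩
  · refine ⟨?_, twist_snoc_one _ v, twist_snoc_two _ v⟩
    rw [b, twist_snoc_zero, rot_one]
  · simp only [b₁_eq_frag, b₂_eq_frag]
    refine ⟨?_, frag_snoc_one i 1 0 v, frag_snoc_two i 1 0 v, ?_, frag_snoc_one i 0 1 v,
      frag_snoc_two i 0 1 v⟩ <;>
    · rw [frag_snoc_zero]
      simp [coord, rot]
  · refine ⟨nonempty_H_equiv i, fun j => ?_, fun h hh => ?_, fun h hh h1 => frag_isUnique_coord hh h1,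
      fun h hh => ?_, fun g hg hxi => existsUnique_germ hg hxi,
      fun g hg => existsUnique_inBranch hg⟩
    · rw [b₁_eq_frag, b₂_eq_frag, actsAs_frag_iff, actsAs_frag_iff]
      simp [coord]
    · obtain ⟨p, q, rfl⟩ := mem_H_iff.1 hh
      exact ⟨fun x hx => frag_apply_of_b_apply_eq hx,
        fun j => ⟨_, actsAs_frag_iff.2 rfl, fun c hc => actsAs_frag_iff.1 hc⟩⟩
    · obtain ⟨p, q, rfl⟩ := mem_H_iff.1 hh
      exact frag_xi i p q
  · have h := (abs_sub_lt_iff.1 (exponent_bounds hη)).2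
    norm_num at h ⊢
    linarith
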